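/- Let $B\ge 0$ and $N_B\ge 2$ be integers, $\alpha>2$, $\lambda_F,\lambda_R,P_F,P_R>0$, $\sigma^2\ge 0$, $0\le p_{hit}\le 1$, and put $$\zeta=1-2^B\beta\Big(2^B,\tfrac{N_B}{N_B-1}\Big),\qquad \upsilon=2^{-B/(N_B-1)},\qquad C(\alpha)=\frac{2\pi/\alpha}{\sin(2\pi/\alpha)},$$ where $\beta(x,y)=\Gamma(x)\Gamma(y)/\Gamma(x+y)$. In the plane $\mathbb R^2$, let the F-APs (fog access points) and the RRHs (remote radio heads) form independent homogeneous Poisson point processes $\Phi_F,\Phi_R$ of densities $\lambda_F,\lambda_R$. The power gains $|h_x|^2$ of the channels from the base stations (BSs) $x$ to the typical user, who is at the origin, are i.i.d. $\mathrm{Exp}(1)$ and independent of the positions. Each F-AP holds the requested content with probability $p_{hit}$, independently of positions and gains (the indicators of different F-APs may be independent or dependent on one another). The tiers are $F_c$ (F-APs with the content), $\tilde F_c$ (F-APs without it) and $R$ (RRHs), with densities $\lambda_{F_c}=p_{hit}\lambda_F$, $\lambda_{\tilde F_c}=(1-p_{hit})\lambda_F$, $\lambda_R$ and powers $P_{F_c}=P_{\tilde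 F_c}=P_F$, $P_R$. With $S_x=P_x|h_x|^2\|x\|^{-\alpha}$, where $P_x$ is $P_F$ or $P_R$, the SINR of the user at an F-AP $x$ and at an RRH $y$ is, respectively, $$\gamma_x=\frac{S_x}{\sum_{x'\in\Phi_F\setminus x}S_{x'}+\sum_{y'\in\Phi_R}S_{y'}+\sigma^2},\qquad \gamma_y=\frac{\zeta S_y}{\sum_{x'\in\Phi_F}S_{x'}+\upsilon\sum_{y'\in\Phi_R\setminus y}S_{y'}+\sigma^2}.$$ For thresholds $\eta=(\eta_{F_c},\eta_{\tilde F_c},\eta_R)$ put $$\begin{aligned}S(\eta,\alpha)=\;&\lambda_R\int_{\mathbb R^2}\exp\Big(-\pi r^2\Big(\frac{\eta_R}{\zeta P_R}\Big)^{2/\alpha}C(\alpha)\Big(\lambda_R(\upsilon P_R)^{2/\alpha}+\sum_{m\in\{F_c,\tilde F_c\}}\lambda_mP_m^{2/\alpha}\Big)\Big)\exp\Big(-\frac{\eta_R r^\alpha\sigma^2}{\zeta P_R}\Big)\,dx\\ &+\sum_{i\in\{F_c,\tilde F_c\}}\lambda_i\int_{\mathbb R^2}\exp\Big(-\pi r^2\Big(\frac{\eta_i}{P_i}\Big)^{2/\alpha}C(\alpha)\sum_{m\in\{F_c,\tilde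 F_c,R\}}\lambda_mP_m^{2/\alpha}\Big)\exp\Big(-\frac{\eta_i r^\alpha\sigma^2}{P_i}\Big)\,dx,\end{aligned}$$ where $r=\|x\|$. Call $\eta$ large if $\eta_{F_c}>1$, $\eta_{\tilde F_c}>1$ and $\eta_R>\zeta/\upsilon$; then at most one BS can have an SINR above the threshold of its tier. (a) For all large $\eta$, the probability that some BS has an SINR above the threshold of its tier is $S(\eta,\alpha)$. (b) Let $N_i\ge 0$ be the number of users per BS of tier $i$, $\xi\ge 0$ the service requested rate of a user, $L>0$ the content length, and $D_{F_c}=0$, $D_{\tilde F_c}=D_{back}\ge 0$, $D_R=D_{front}\ge 0$ the latencies of the links behind the BSs. A BS $x$ of tier $i$ with service rate $R_x$ has delivery latency $D_x=L/(R_x-N_i\xi L)+D_i$ (infinite if $R_x\le N_i\xi L$). Let $\beta_i>D_i$ be the latency targets and $\kappa_i=N_i\xi L+L/(\beta_i-D_i)$. Under the minimal delay association policy a delivery succeeds if some BS $x$, of tier $i$ say, has $D_x<\beta_i$. If $R_x=\log_2(1+\gamma_x)$ and the thresholds $\eta_i=2^{\kappa_i}-1$ are large, the successful delivery probability is $S(\eta,\alpha)$.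 If the service rate is identified with the SINR, $R_x=\gamma_x$, and the thresholds $\eta_i=\kappa_i$ are large, it is $S(\eta,\alpha)$ as well. -/

import Mathlib

open MeasureTheory ProbabilityTheory
open scoped ENNReal

noncomputable section

namespace FogRAN

/-- The plane in which the base stations are deployed; the typical user sits at the origin. -/
abbrev Plane : Type := EuclideanSpace ℝ (Fin 2)

/-- The three tiers seen by a user with a given request: F-APs holding the requested content,
F-APs not holding it, and RRHs. -/
inductive Tier : Type
  | withContent : Tier
  | withoutContent : Tier
  | rrh : Tier

/-- Base stations: `Sum.inl n` is the `n`-th F-AP and `Sum.inr n` is the `n`-th RRH. -/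
abbrev Station : Type := ℕ ⊕ ℕ

/-- The numerical parameters of the radio network. -/
structure RadioParams where
  /-- density of the F-APs -/
  densF : ℝ
  /-- density of the RRHs -/
  densR : ℝ
  /-- caching hit probability -/
  pHit : ℝ
  /-- transmit power of an F-AP -/
  powF : ℝ
  /-- transmit power of an RRH -/
  powR : ℝ
  /-- path loss exponent -/
  α : ℝ
  /-- noise variance `σ²` -/
  noise : ℝ
  /-- number of feedback bits -/
  bits : ℕ
  /-- number of antennas of an RRH -/
  antennas : ℕ

/-- The standing ranges of the parameters. -/
structure RadioParams.Valid (p : RadioParams) : Prop where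
  densF_pos : 0 < p.densF
  densR_pos : 0 < p.densR
  pHit_nonneg : 0 ≤ p.pHit
  pHit_le_one : p.pHit ≤ 1
  powF_pos : 0 < p.powF
  powR_pos : 0 < p.powR
  two_lt_α : 2 < p.α
  noise_nonneg : 0 ≤ p.noise
  two_le_antennas : 2 ≤ p.antennas

namespace RadioParams

variable (p : RadioParams)

/-- Density of a tier: `λ_F p_hit`, `λ_F (1 - p_hit)`, `λ_R`. -/
def dens : Tier → ℝ
  | .withContent => p.pHit * p.densF
  | .withoutContent => (1 - p.pHit) * p.densF
  | .rrh => p.densR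

/-- Transmit power of a tier. -/
def pow : Tier → ℝ
  | .withContent => p.powF
  | .withoutContent => p.powF
  | .rrh => p.powR

/-- The coefficient `ζ = 1 - 2^B β(2^B, N_B / (N_B - 1))` of the desired signal under quantized
channel direction information with `B` feedback bits and `N_B` antennas. -/
def zeta : ℝ :=
  1 - (2 : ℝ) ^ p.bits *
    ProbabilityTheory.beta ((2 : ℝ) ^ p.bits) ((p.antennas : ℝ) / ((p.antennas : ℝ) - 1))

/-- The residual interference coefficient `υ = 2^(-B / (N_B - 1))`. -/
def upsilon : ℝ :=
  (2 : ℝ) ^ (-((p.bits : ℝ) / ((p.antennas : ℝ) - 1)))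

/-- `C(α) = (2π/α) / sin (2π/α)`. -/
def cAlpha : ℝ :=
  (2 * Real.pi / p.α) / Real.sin (2 * Real.pi / p.α)

/-- The contribution of an F-AP tier `i` with SINR threshold `η`. -/
def fapTerm (i : Tier) (η : ℝ) : ℝ :=
  p.dens i * ∫ x : Plane,
    Real.exp (-(Real.pi * ‖x‖ ^ 2 * (η / p.pow i) ^ (2 / p.α) * p.cAlpha *
      (p.dens .withContent * p.pow .withContent ^ (2 / p.α)
        + p.dens .withoutContent * p.pow .withoutContent ^ (2 / p.α)
        + p.dens .rrh * p.pow .rrh ^ (2 / p.α)))) *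
    Real.exp (-(η * ‖x‖ ^ p.α * p.noise / p.pow i))

/-- The contribution of the RRH tier with SINR threshold `η`. -/
def rrhTerm (η : ℝ) : ℝ :=
  p.dens .rrh * ∫ x : Plane,
    Real.exp (-(Real.pi * ‖x‖ ^ 2 * (η / (p.zeta * p.pow .rrh)) ^ (2 / p.α) * p.cAlpha *
      (p.dens .rrh * (p.upsilon * p.pow .rrh) ^ (2 / p.α)
        + (p.dens .withContent * p.pow .withContent ^ (2 / p.α)
          + p.dens .withoutContent * p.pow .withoutContent ^ (2 / p.α))))) *
    Real.exp (-(η * ‖x‖ ^ p.α * p.noise / (p.zeta * p.pow .rrh)))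

/-- The right-hand side `S({η_i}, α)`. -/
def successFormula (η : Tier → ℝ) : ℝ :=
  p.rrhTerm (η .rrh)
    + (p.fapTerm .withContent (η .withContent) + p.fapTerm .withoutContent (η .withoutContent))

/-- Thresholds so large that at most one base station can qualify. -/
def LargeThresholds (η : Tier → ℝ) : Prop :=
  1 < η .withContent ∧ 1 < η .withoutContent ∧ p.zeta / p.upsilon < η .rrh

end RadioParams

section Model

variable {Ω : Type*} [MeasurableSpace Ω]

/-- Number of points of the random sequence `X` that lie in `A`. -/
def pointCount (X : ℕ → Ω → Plane) (A : Set Plane) (ω : Ω) : ℝ≥0∞ :=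
  ∑' n, A.indicator (fun _ => (1 : ℝ≥0∞)) (X n ω)

/-- `X` enumerates the points of a homogeneous Poisson point process of density `d` on the plane:
the number of points in a Borel set of finite area `a` is Poisson with mean `d * a`, and the
numbers of points in finitely many disjoint Borel sets are independent. -/
structure IsPoissonProcess (μ : Measure Ω) (X : ℕ → Ω → Plane) (d : ℝ) : Prop where
  measurable : ∀ n, Measurable (X n)
  law : ∀ A : Set Plane, MeasurableSet A → volume A ≠ ∞ → ∀ k : ℕ,
    μ {ω | pointCount X A ω = k} =
      ENNReal.ofReal (Real.exp (-(d * volume.real A)) * (d * volume.real A) ^ k /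
        (Nat.factorial k : ℝ))
  indep : ∀ (k : ℕ) (A : Fin k → Set Plane), (∀ i, MeasurableSet (A i)) →
    (∀ i j, i ≠ j → Disjoint (A i) (A j)) →
    iIndepFun (fun i => pointCount X (A i)) μ

/-- The random ingredients of the network: positions of the base stations, fading gains `|h|²`
to the typical user, and for every F-AP whether it holds the requested content. -/
structure Network (Ω : Type*) where
  position : Station → Ω → Plane
  fading : Station → Ω → ℝ
  hasContent : ℕ → Ω → Bool

/-- The law of the network. F-APs and RRHs form independent homogeneous Poisson processes, the
fading gains are i.i.d. `Exp(1)` and independent of the positions, and every F-AP holds the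
requested content with probability `pHit`, independently of positions and fading. Nothing is
assumed on the joint law of the content indicators: they may be independent (then the F-APs with
and without the content are independent Poisson processes of densities `λ_F p_hit` and
`λ_F (1 - p_hit)`), or all equal (all F-APs cache the same contents, and the request is random). -/
structure IsFogNetwork (μ : Measure Ω) (p : RadioParams) (net : Network Ω) : Prop where
  fap_poisson : IsPoissonProcess μ (fun n => net.position (Sum.inl n)) p.densF
  rrh_poisson : IsPoissonProcess μ (fun n => net.position (Sum.inr n)) p.densR
  indep_positions : IndepFun (fun ω (n : ℕ) => net.position (Sum.inl n) ω)
    (fun ω (n : ℕ) => net.position (Sum.inr n) ω) μ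
  fading_measurable : ∀ s, Measurable (net.fading s)
  fading_law : ∀ s, μ.map (net.fading s) = expMeasure 1
  fading_indep : iIndepFun net.fading μ
  indep_fading : IndepFun (fun ω s => net.position s ω) (fun ω s => net.fading s ω) μ
  content_measurable : ∀ n, Measurable (net.hasContent n)
  content_law : ∀ n, μ {ω | net.hasContent n ω = true} = ENNReal.ofReal p.pHit
  indep_content : IndepFun
    (fun ω => ((fun s => net.position s ω, fun s => net.fading s ω) :
      (Station → Plane) × (Station → ℝ)))
    (fun ω n => net.hasContent n ω) μ

namespace Network

variable (net : Network Ω) (p : RadioParams)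

/-- The tier of a base station. -/
def tier (ω : Ω) : Station → Tier
  | Sum.inl n => if net.hasContent n ω then .withContent else .withoutContent
  | Sum.inr _ => .rrh

/-- Received power `P |h|² r^(-α)` at the origin from a base station. -/
def rx (ω : Ω) (s : Station) : ℝ≥0∞ :=
  ENNReal.ofReal (p.pow (net.tier ω s) * net.fading s ω * ‖net.position s ω‖ ^ (-p.α))

/-- The SINR of the typical user when it is served by a given base station. When an RRH serves,
its signal is multiplied by `ζ` and the interference of the other RRHs by `υ`. -/
def sinr (ω : Ω) : Station → ℝ≥0∞
  | Sum.inl n => net.rx p ω (Sum.inl n) /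
      ((∑' m : ℕ, if m = n then 0 else net.rx p ω (Sum.inl m))
        + (∑' m : ℕ, net.rx p ω (Sum.inr m)) + ENNReal.ofReal p.noise)
  | Sum.inr n => ENNReal.ofReal p.zeta * net.rx p ω (Sum.inr n) /
      ((∑' m : ℕ, net.rx p ω (Sum.inl m))
        + ENNReal.ofReal p.upsilon * (∑' m : ℕ, if m = n then 0 else net.rx p ω (Sum.inr m))
        + ENNReal.ofReal p.noise)

end Network

end Model

/-- The Shannon rate `log₂ (1 + γ)` at SINR `γ`. -/
def shannonRate (γ : ℝ≥0∞) : ℝ≥0∞ :=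
  (ENNReal.log (1 + γ)).toENNReal / ENNReal.ofReal (Real.log 2)

/-- The parameters of the delivery latency. -/
structure DelayParams where
  /-- number of users served by a base station of a tier -/
  users : Tier → ℝ
  /-- service requested rate of a user -/
  reqRate : ℝ
  /-- length of a content -/
  len : ℝ
  /-- latency of the backhaul links -/
  back : ℝ
  /-- latency of the fronthaul links -/
  front : ℝ
  /-- latency target of each tier -/
  target : Tier → ℝ

namespace DelayParams

variable (q : DelayParams)

/-- The additional latency of a tier: none, backhaul, fronthaul. -/
def extra : Tier → ℝ
  | .withContent => 0
  | .withoutContent => q.back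
  | .rrh => q.front

/-- The standing ranges of the delay parameters. A target that does not exceed the fixed latency
of its tier could never be met. -/
structure Valid : Prop where
  users_nonneg : ∀ i, 0 ≤ q.users i
  reqRate_nonneg : 0 ≤ q.reqRate
  len_pos : 0 < q.len
  back_nonneg : 0 ≤ q.back
  front_nonneg : 0 ≤ q.front
  extra_lt_target : ∀ i, q.extra i < q.target i

/-- The delivery latency `L / (R - N ξ L) + D` at a base station of tier `i` with service rate `R`,
where `D` is the latency of the link behind the base station. It is infinite when the rate does
not exceed the traffic `N ξ L`. -/
def latency (i : Tier) (R : ℝ≥0∞) : ℝ≥0∞ :=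
  ENNReal.ofReal q.len / (R - ENNReal.ofReal (q.users i * q.reqRate * q.len))
    + ENNReal.ofReal (q.extra i)

/-- `N_i ξ L + L / (β_i - D_i)`. -/
def kappa (i : Tier) : ℝ :=
  q.users i * q.reqRate * q.len + q.len / (q.target i - q.extra i)

end DelayParams

end FogRAN

end

/-! For large thresholds, a base station above its threshold is received strictly more strongly than
every other one. Hence the events "station `s` qualifies" are pairwise disjoint, and the probability
that some station qualifies is the sum of their probabilities, that is, the mean number of
qualifying stations.

To compute this mean for one tier, condition on the positions. The serving gain is `Exp(1)`, so it
exceeds an independent level `J` with probability `E exp (-J)`. Since `J` is a weighted sum of the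
other independent gains plus noise, this expectation is a product of factors `1 / (1 + a)` times a
noise factor. Written as `expNeg` of a sum of `logOneAdd a`, the product is an exponential
functional of the two point processes. The Laplace functional
(`IsPoissonProcess.lintegral_expNeg_tsum`) handles the tier that does not serve, and the reduced
Campbell formula (`IsPoissonProcess.lintegral_tsum_indicator_mul_expNeg`), obtained by
differentiating the Laplace functional, handles the serving one. The plane integral of `1 - 1 / (1 +
s r ^ (-α))` produces `C(α)`.

The Campbell formula used here treats a functional of the other points that does not depend on the
serving point, whereas the weights involve the serving distance. The distance is therefore first
frozen at a constant `r`. The functional decreases in `r`, so rounding distances to powers of `θ`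
and letting `θ` tend to 1 restores the true distance (`lintegral_tsum_norm`). This gives
`tsum_measure_interference_lt`. It is applied once with F-APs serving and once, after exchanging the
two kinds of station, with RRHs serving.

Content indicators do not affect the received powers, because both F-AP tiers transmit with the same
power. Each event involves only the indicator of the serving F-AP, which contributes a factor
`p_hit` or `1 - p_hit`, so the joint law of the indicators is irrelevant. Finally, latency decreases
in the rate, so a latency target is an SINR threshold. -/

noncomputable section

namespace FogRAN

open Filter Topology

/-! ### Exponential and logarithm on `[0, ∞]` -/

/-- The decreasing exponential `t ↦ exp (-t)` on the extended nonnegative reals. -/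
def expNeg (t : ℝ≥0∞) : ℝ≥0∞ := (EReal.exp (t : EReal))⁻¹

/-- `log (1 + a)` on the extended nonnegative reals. -/
def logOneAdd (a : ℝ≥0∞) : ℝ≥0∞ := (ENNReal.log (1 + a)).toENNReal

@[simp] lemma expNeg_zero : expNeg 0 = 1 := by simp [expNeg]

@[simp] lemma expNeg_top : expNeg ∞ = 0 := by simp [expNeg]

lemma expNeg_ofReal {t : ℝ} (ht : 0 ≤ t) :
    expNeg (ENNReal.ofReal t) = ENNReal.ofReal (Real.exp (-t)) := by
  rw [expNeg, EReal.coe_ennreal_ofReal, max_eq_left ht, EReal.exp_coe,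
    ← ENNReal.ofReal_inv_of_pos (Real.exp_pos t), Real.exp_neg]

lemma expNeg_add (a b : ℝ≥0∞) : expNeg (a + b) = expNeg a * expNeg b := by
  have h : ∀ t : ℝ≥0∞, EReal.exp (t : EReal) ≠ 0 := fun t => by
    simp [EReal.exp_eq_zero_iff]
  rw [expNeg, expNeg, expNeg, EReal.coe_ennreal_add, EReal.exp_add,
    ENNReal.mul_inv (Or.inl (h a)) (Or.inr (h b))]

lemma expNeg_antitone : Antitone expNeg := fun a b hab => by
  unfold expNeg
  exact ENNReal.inv_le_inv.2 (EReal.exp_monotone (by exact_mod_cast hab))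

lemma expNeg_le_one (t : ℝ≥0∞) : expNeg t ≤ 1 := by
  simpa using expNeg_antitone (zero_le (a := t))

lemma expNeg_ne_top (t : ℝ≥0∞) : expNeg t ≠ ∞ :=
  ne_top_of_le_ne_top ENNReal.one_ne_top (expNeg_le_one t)

lemma expNeg_ne_zero {t : ℝ≥0∞} (ht : t ≠ ∞) : expNeg t ≠ 0 := by
  simp [expNeg, ht]

lemma continuous_expNeg : Continuous expNeg :=
  (ENNReal.continuous_exp.comp continuous_coe_ennreal_ereal).inv

@[fun_prop]
lemma measurable_expNeg : Measurable expNeg := continuous_expNeg.measurable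

lemma expNeg_sum {ι : Type*} (s : Finset ι) (f : ι → ℝ≥0∞) :
    expNeg (∑ i ∈ s, f i) = ∏ i ∈ s, expNeg (f i) := by
  classical
  induction s using Finset.induction_on with
  | empty => simp
  | insert a s ha ih => rw [Finset.sum_insert ha, Finset.prod_insert ha, expNeg_add, ih]

lemma expNeg_mul_natCast (a : ℝ≥0∞) (k : ℕ) : expNeg (a * k) = expNeg a ^ k := by
  induction k with
  | zero => simp
  | succ k ih => rw [Nat.cast_succ, mul_add, mul_one, expNeg_add, ih, pow_succ]

lemma tendsto_expNeg_sum {ι : Type*} (f : ι → ℝ≥0∞) :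
    Tendsto (fun s : Finset ι => expNeg (∑ i ∈ s, f i)) atTop (𝓝 (expNeg (∑' i, f i))) :=
  (continuous_expNeg.tendsto _).comp ENNReal.summable.hasSum

@[fun_prop]
lemma measurable_logOneAdd : Measurable logOneAdd := by
  unfold logOneAdd
  exact ((measurable_const.add measurable_id).ennreal_log).ereal_toENNReal

lemma logOneAdd_coe (a : ℝ≥0∞) : ((logOneAdd a : ℝ≥0∞) : EReal) = ENNReal.log (1 + a) :=
  EReal.coe_toENNReal (ENNReal.zero_le_log_iff.2 le_self_add)

-- This turns a product of fading factors `1 / (1 + a)` into `expNeg` of a sum over points, the form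
-- to which the Laplace functional applies.
@[simp] lemma expNeg_logOneAdd (a : ℝ≥0∞) : expNeg (logOneAdd a) = (1 + a)⁻¹ := by
  rw [expNeg, logOneAdd_coe, ENNReal.exp_log]

@[simp] lemma logOneAdd_zero : logOneAdd 0 = 0 := by simp [logOneAdd]

lemma logOneAdd_mono : Monotone logOneAdd := fun a b hab =>
  EReal.toENNReal_le_toENNReal (ENNReal.log_monotone (by gcongr))

lemma logOneAdd_ne_top {a : ℝ≥0∞} (ha : a ≠ ∞) : logOneAdd a ≠ ∞ := by
  simp [logOneAdd, ha]

/-! ### Exponential fading gains -/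

section Fading

variable {Ω : Type*} [MeasurableSpace Ω] {μ : Measure Ω}

lemma expMeasure_one_Ioi {t : ℝ} (ht : 0 ≤ t) :
    expMeasure 1 (Set.Ioi t) = ENNReal.ofReal (Real.exp (-t)) := by
  have : IsProbabilityMeasure (expMeasure 1) := isProbabilityMeasure_expMeasure one_pos
  have h := cdf_expMeasure_eq one_pos t
  rw [cdf_eq_real, if_pos ht, one_mul] at h
  rw [← Set.compl_Iic, prob_compl_eq_one_sub measurableSet_Iic, ← ofReal_measureReal, h,
    ← ENNReal.ofReal_one, ← ENNReal.ofReal_sub _ (by simpa using ht)]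
  congr 1; ring

lemma measure_lt_of_map_eq_expMeasure {X : Ω → ℝ} (hX : Measurable X)
    (hlaw : μ.map X = expMeasure 1) (J : ℝ≥0∞) :
    μ {ω | J < ENNReal.ofReal (X ω)} = expNeg J := by
  by_cases hJ : J = ∞
  · simp [hJ]
  have h0 := ENNReal.toReal_nonneg (a := J)
  rw [← ENNReal.ofReal_toReal hJ, expNeg_ofReal h0, ← expMeasure_one_Ioi h0, ← hlaw,
    Measure.map_apply hX measurableSet_Ioi]
  congr 1 with ω
  simp [ENNReal.ofReal_lt_ofReal_iff']
  exact fun h => h0.trans_lt h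

lemma lintegral_expNeg_mul_of_map_eq_expMeasure {X : Ω → ℝ} (hX : Measurable X)
    (hlaw : μ.map X = expMeasure 1) {a : ℝ≥0∞} (ha : a ≠ ∞) :
    ∫⁻ ω, expNeg (a * ENNReal.ofReal (X ω)) ∂μ = (1 + a)⁻¹ := by
  have hm : Measurable fun x : ℝ => expNeg (a * ENNReal.ofReal x) := by fun_prop
  rw [← lintegral_map (f := fun x : ℝ => expNeg (a * ENNReal.ofReal x)) hm hX, hlaw]
  obtain ⟨t, ht, rfl⟩ : ∃ t : ℝ, 0 ≤ t ∧ a = ENNReal.ofReal t :=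
    ⟨a.toReal, ENNReal.toReal_nonneg, (ENNReal.ofReal_toReal ha).symm⟩
  have ht' : 0 < 1 + t := by linarith
  -- Tilting the `Exp(1)` density by `exp (-t x)` and multiplying by `1 + t` gives the density of
  -- `Exp(1 + t)`, of total mass 1.
  have h1 : ENNReal.ofReal (1 + t) *
      ∫⁻ x, expNeg (ENNReal.ofReal t * ENNReal.ofReal x) ∂(expMeasure 1) = 1 := by
    rw [← lintegral_const_mul _ hm, expMeasure, gammaMeasure,
      lintegral_withDensity_eq_lintegral_mul _
        (show Measurable (gammaPDF 1 1) from (measurable_gammaPDFReal 1 1).ennreal_ofReal)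
        (hm.const_mul _), ← lintegral_exponentialPDF_eq_one ht']
    refine lintegral_congr fun x => ?_
    simp only [Pi.mul_apply]
    change exponentialPDF 1 x * _ = _
    rcases lt_or_ge x 0 with hx | hx
    · simp [exponentialPDF_of_neg hx]
    · rw [exponentialPDF_of_nonneg hx, exponentialPDF_of_nonneg hx, ← ENNReal.ofReal_mul ht,
        expNeg_ofReal (by positivity), ← ENNReal.ofReal_mul ht'.le,
        ← ENNReal.ofReal_mul (by positivity)]
      congr 1
      rw [show -((1 + t) * x) = -(1 * x) + -(t * x) by ring, Real.exp_add]
      ring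
  rw [← ENNReal.ofReal_one, ← ENNReal.ofReal_add zero_le_one ht]
  exact ENNReal.eq_inv_of_mul_eq_one_left (by rw [mul_comm]; exact h1)

variable [IsProbabilityMeasure μ] {ι : Type*} [Countable ι] {H : ι → Ω → ℝ}

/-- For finitely many gains, independence factorizes the expectation. The bound `expNeg ≤ 1` lets
dominated convergence pass to the full sum, even when that sum is infinite. -/
lemma lintegral_expNeg_tsum_fading (hm : ∀ i, Measurable (H i))
    (hlaw : ∀ i, μ.map (H i) = expMeasure 1) (hind : iIndepFun H μ)
    {a : ι → ℝ≥0∞} (ha : ∀ i, a i ≠ ∞) :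
    ∫⁻ ω, expNeg (∑' i, a i * ENNReal.ofReal (H i ω)) ∂μ = expNeg (∑' i, logOneAdd (a i)) := by
  have hX : ∀ i, Measurable fun ω => expNeg (a i * ENNReal.ofReal (H i ω)) := fun i => by
    have := hm i
    fun_prop
  have h1 : Tendsto (fun s : Finset ι =>
      ∫⁻ ω, expNeg (∑ i ∈ s, a i * ENNReal.ofReal (H i ω)) ∂μ) atTop
      (𝓝 (∫⁻ ω, expNeg (∑' i, a i * ENNReal.ofReal (H i ω)) ∂μ)) := by
    refine tendsto_lintegral_filter_of_dominated_convergence (fun _ => 1)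
      (.of_forall fun s => ?_) (.of_forall fun s => .of_forall fun ω => expNeg_le_one _) (by simp)
      (.of_forall fun ω => tendsto_expNeg_sum _)
    simp only [expNeg_sum]
    exact Finset.measurable_fun_prod _ fun i _ => hX i
  refine tendsto_nhds_unique h1 ?_
  have h2 : ∀ s : Finset ι, ∫⁻ ω, expNeg (∑ i ∈ s, a i * ENNReal.ofReal (H i ω)) ∂μ
      = expNeg (∑ i ∈ s, logOneAdd (a i)) := fun s => by
    simp only [expNeg_sum]
    have hi : iIndepFun (fun i ω => expNeg (a i * ENNReal.ofReal (H i ω))) μ :=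
      hind.comp (fun i x => expNeg (a i * ENNReal.ofReal x)) fun i => by fun_prop
    rw [lintegral_prod_eq_prod_lintegral_of_indepFun s _ hi hX]
    refine Finset.prod_congr rfl fun i _ => ?_
    rw [lintegral_expNeg_mul_of_map_eq_expMeasure (hm i) (hlaw i) (ha i), expNeg_logOneAdd]
  simp only [h2]
  exact tendsto_expNeg_sum _

lemma measure_prodMk_mem_of_indepFun {E F : Type*} [MeasurableSpace E] [MeasurableSpace F]
    {Q : Ω → E} {R : Ω → F} (hQ : Measurable Q) (hR : Measurable R) (hind : IndepFun Q R μ)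
    {B : Set (E × F)} (hB : MeasurableSet B) :
    μ {ω | (Q ω, R ω) ∈ B} = ∫⁻ ω, μ {ω' | (Q ω, R ω') ∈ B} ∂μ := by
  have h := (indepFun_iff_map_prod_eq_prod_map_map hQ.aemeasurable hR.aemeasurable).1 hind
  have h1 : μ {ω | (Q ω, R ω) ∈ B} = μ.map (fun ω => (Q ω, R ω)) B := by
    rw [Measure.map_apply (hQ.prodMk hR) hB]; rfl
  have : IsProbabilityMeasure (μ.map R) := Measure.isProbabilityMeasure_map hR.aemeasurable
  rw [h1, h, Measure.prod_apply hB, lintegral_map (measurable_measure_prodMk_left hB) hQ]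
  refine lintegral_congr fun ω => ?_
  rw [Measure.map_apply hR (measurable_prodMk_left hB)]
  rfl

/-- The condition `a n = 0` makes the interference a function of the gains other than `H n`, hence
independent of `H n`. Conditioning on it leaves the exponential tail, whose mean is the Laplace
transform above. -/
lemma measure_tsum_lt_fading (hm : ∀ i, Measurable (H i))
    (hlaw : ∀ i, μ.map (H i) = expMeasure 1) (hind : iIndepFun H μ)
    {a : ι → ℝ≥0∞} (ha : ∀ i, a i ≠ ∞) {n : ι} (hn : a n = 0) (b : ℝ≥0∞) :
    μ {ω | ∑' i, a i * ENNReal.ofReal (H i ω) + b < ENNReal.ofReal (H n ω)}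
      = expNeg (∑' i, logOneAdd (a i) + b) := by
  set J : Ω → ℝ≥0∞ := fun ω => ∑' i, a i * ENNReal.ofReal (H i ω) + b with hJ
  -- The σ-algebra is left free: it is the ambient one for `hJm`, and the one generated by the other
  -- gains for `hJn`.
  have hmeas : ∀ m : MeasurableSpace Ω, (∀ i, Measurable[m] fun ω =>
      a i * ENNReal.ofReal (H i ω)) → Measurable[m] J := fun m h =>
    (Measurable.tsum h).add measurable_const
  have hJm : Measurable J := by
    refine hmeas _ fun i => ?_
    have := hm i
    fun_prop
  have hJn : IndepFun J (H n) μ := by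
    have h := indep_iSup_of_disjoint (m := fun i => MeasurableSpace.comap (H i) inferInstance)
      (fun i => (hm i).comap_le) hind (S := {n}ᶜ) (T := {n}) (disjoint_compl_left)
    rw [IndepFun_iff_Indep]
    refine indep_of_indep_of_le_left (indep_of_indep_of_le_right h ?_) ?_
    · exact le_iSup₂_of_le n rfl le_rfl
    · rw [← measurable_iff_comap_le]
      refine hmeas _ fun i => ?_
      by_cases hi : i = n
      · subst hi; simp [hn]
      · refine measurable_const.mul (Measurable.ennreal_ofReal ?_)
        have hle : MeasurableSpace.comap (H i) inferInstance ≤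
            ⨆ j ∈ ({n}ᶜ : Set ι), MeasurableSpace.comap (H j) inferInstance :=
          le_iSup₂_of_le (f := fun j (_ : j ∈ ({n}ᶜ : Set ι)) =>
            MeasurableSpace.comap (H j) inferInstance) i hi le_rfl
        exact Measurable.mono (comap_measurable (H i)) hle le_rfl
  have hB : MeasurableSet {z : ℝ≥0∞ × ℝ | z.1 < ENNReal.ofReal z.2} :=
    measurableSet_lt measurable_fst (by fun_prop)
  have h1 := measure_prodMk_mem_of_indepFun hJm (hm n) hJn hB
  simp only [Set.mem_ofPred_eq] at h1
  rw [h1]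
  simp only [fun ω => measure_lt_of_map_eq_expMeasure (hm n) (hlaw n) (J ω)]
  simp only [hJ, expNeg_add]
  rw [lintegral_mul_const', lintegral_expNeg_tsum_fading hm hlaw hind ha]
  exact expNeg_ne_top _

end Fading

/-! ### The Laplace functional of a Poisson process -/

section PoissonProcess

lemma tsum_indicator_const_eq {Ω : Type*} {X : ℕ → Ω → Plane} (A : Set Plane) (a : ℝ≥0∞) (ω : Ω) :
    ∑' n, A.indicator (fun _ => a) (X n ω) = a * pointCount X A ω := by
  rw [pointCount, ← ENNReal.tsum_mul_left]
  refine tsum_congr fun n => ?_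
  by_cases h : X n ω ∈ A <;> simp [h]

variable {Ω : Type*} [MeasurableSpace Ω] {μ : Measure Ω} {X : ℕ → Ω → Plane} {d : ℝ}

lemma IsPoissonProcess.measurable_pointCount (hX : IsPoissonProcess μ X d) {A : Set Plane}
    (hA : MeasurableSet A) : Measurable (pointCount X A) := by
  unfold pointCount
  exact Measurable.tsum fun n => (measurable_const.indicator hA).comp (hX.measurable n)

variable [IsProbabilityMeasure μ]

lemma IsPoissonProcess.lintegral_expNeg_mul_pointCount (hX : IsPoissonProcess μ X d) (hd : 0 ≤ d)
    {A : Set Plane} (hA : MeasurableSet A) (hA' : volume A ≠ ∞) (a : ℝ≥0∞) :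
    ∫⁻ ω, expNeg (a * pointCount X A ω) ∂μ
      = expNeg (ENNReal.ofReal d * (volume A * (1 - expNeg a))) := by
  set N := pointCount X A
  have hN : Measurable N := hX.measurable_pointCount hA
  set m : ℝ := d * volume.real A with hm
  have hm0 : 0 ≤ m := by positivity
  -- The generating function of the Poisson law. At `c = 1` it shows that the count is almost surely
  -- a natural number; at `c = expNeg a` it gives the claim.
  have hser : ∀ c : ℝ, 0 ≤ c → ∑' k : ℕ, ENNReal.ofReal c ^ k * μ {ω | N ω = k}
      = ENNReal.ofReal (Real.exp (-(m * (1 - c)))) := by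
    intro c hc
    have h1 : ∀ k : ℕ, ENNReal.ofReal c ^ k * μ {ω | N ω = k}
        = ENNReal.ofReal (Real.exp (-m) * ((m * c) ^ k / (Nat.factorial k : ℝ))) := by
      intro k
      rw [hX.law A hA hA' k, ← ENNReal.ofReal_pow hc, ← ENNReal.ofReal_mul (by positivity)]
      congr 1
      rw [mul_pow]; ring
    have hsum : HasSum (fun k : ℕ => (m * c) ^ k / (Nat.factorial k : ℝ)) (Real.exp (m * c)) := by
      rw [Real.exp_eq_exp_ℝ]
      exact NormedSpace.expSeries_div_hasSum_exp (m * c)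
    have h2 := hsum.mul_left (Real.exp (-m))
    simp only [h1]
    rw [← ENNReal.ofReal_tsum_of_nonneg (fun k => by positivity) h2.summable, h2.tsum_eq,
      ← Real.exp_add]
    congr 2; ring
  have hms : ∀ k : ℕ, MeasurableSet {ω | N ω = k} := fun k =>
    hN (measurableSet_singleton (k : ℝ≥0∞))
  have hdisj : Pairwise (Function.onFun Disjoint fun k : ℕ => {ω | N ω = k}) := by
    intro i j hij
    refine Set.disjoint_left.2 fun ω hi hj => hij ?_
    have h : (i : ℝ≥0∞) = j := Eq.trans (Eq.symm hi) hj
    exact_mod_cast h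
  have hfull : (⋃ k : ℕ, {ω | N ω = k}) =ᵐ[μ] Set.univ := by
    rw [ae_eq_univ, prob_compl_eq_zero_iff (MeasurableSet.iUnion hms),
      measure_iUnion hdisj hms]
    have := hser 1 zero_le_one
    simpa using this
  rw [← setLIntegral_univ, ← setLIntegral_congr hfull, lintegral_iUnion hms hdisj]
  obtain ⟨c, hc0, hc⟩ : ∃ c : ℝ, 0 ≤ c ∧ expNeg a = ENNReal.ofReal c :=
    ⟨(expNeg a).toReal, ENNReal.toReal_nonneg, (ENNReal.ofReal_toReal (expNeg_ne_top a)).symm⟩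
  have hc1 : c ≤ 1 := by
    have := expNeg_le_one a
    rw [hc] at this
    simpa using this
  have h3 : ∀ k : ℕ, ∫⁻ ω in {ω | N ω = k}, expNeg (a * N ω) ∂μ
      = ENNReal.ofReal c ^ k * μ {ω | N ω = k} := by
    intro k
    rw [setLIntegral_congr_fun (hms k) (g := fun _ => ENNReal.ofReal c ^ k), setLIntegral_const]
    intro ω hω
    change N ω = k at hω
    simp only [hω]
    rw [expNeg_mul_natCast, hc]
  simp only [h3]
  rw [hser c hc0, hc, ← ofReal_measureReal hA', ← ENNReal.ofReal_one, ← ENNReal.ofReal_sub _ hc0,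
    ← ENNReal.ofReal_mul (by positivity), ← ENNReal.ofReal_mul hd,
    expNeg_ofReal (mul_nonneg hd (mul_nonneg (by positivity) (by linarith))), hm]
  congr 2; ring_nf

/-- The level sets of `f` inside `D` are disjoint and of finite area, so their counts are
independent Poisson variables and the expectation is a product. The values 0 and ∞ need no separate
treatment. -/
lemma IsPoissonProcess.lintegral_expNeg_simple (hX : IsPoissonProcess μ X d) (hd : 0 ≤ d)
    (f : SimpleFunc Plane ℝ≥0∞) {D : Set Plane} (hD : MeasurableSet D) (hD' : volume D ≠ ∞) :
    ∫⁻ ω, expNeg (∑' n, D.indicator f (X n ω)) ∂μ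
      = expNeg (ENNReal.ofReal d * ∫⁻ x, (1 - expNeg (D.indicator f x))) := by
  set e := f.range.equivFin
  set k := f.range.card
  set a : Fin k → ℝ≥0∞ := fun i => (e.symm i : ℝ≥0∞)
  set A : Fin k → Set Plane := fun i => f ⁻¹' {a i} ∩ D
  have hA : ∀ i, MeasurableSet (A i) := fun i => (f.measurableSet_fiber _).inter hD
  have hA' : ∀ i, volume (A i) ≠ ∞ := fun i =>
    ne_top_of_le_ne_top hD' (measure_mono Set.inter_subset_right)
  have hdis : ∀ i j, i ≠ j → Disjoint (A i) (A j) := by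
    intro i j hij
    refine Set.disjoint_left.2 fun x hi hj => hij ?_
    have h : a i = a j := Eq.trans (Eq.symm hi.1) hj.1
    exact e.symm.injective (Subtype.ext h)
  have hmem : ∀ x ∈ D, ∃ i, x ∈ A i := fun x hx =>
    ⟨e ⟨f x, f.mem_range_self x⟩, by simp [a], hx⟩
  have hsum : ∀ (g : ℝ≥0∞ → ℝ≥0∞), g 0 = 0 → ∀ x, g (D.indicator f x)
      = ∑ i, (A i).indicator (fun _ => g (a i)) x := by
    intro g hg x
    by_cases hx : x ∈ D
    · obtain ⟨i, hi⟩ := hmem x hx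
      rw [Finset.sum_eq_single i, Set.indicator_of_mem hi, Set.indicator_of_mem hx,
        show f x = a i from hi.1]
      · intro j _ hj
        exact Set.indicator_of_notMem (fun h => Set.disjoint_left.1 (hdis j i hj) h hi) _
      · simp
    · rw [Set.indicator_of_notMem hx, hg]
      exact (Finset.sum_eq_zero fun i _ => Set.indicator_of_notMem (fun h => hx h.2) _).symm
  have h1 : ∀ ω, ∑' n, D.indicator f (X n ω) = ∑ i, a i * pointCount X (A i) ω := by
    intro ω
    have h0 : ∀ x, D.indicator f x = ∑ i, (A i).indicator (fun _ => a i) x := hsum id rfl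
    simp only [h0]
    rw [Summable.tsum_finsetSum fun i _ => ENNReal.summable]
    exact Finset.sum_congr rfl fun i _ => tsum_indicator_const_eq _ _ _
  have h2 : ∫⁻ x, (1 - expNeg (D.indicator f x)) = ∑ i, volume (A i) * (1 - expNeg (a i)) := by
    simp only [hsum (fun t => 1 - expNeg t) (by simp)]
    rw [lintegral_finsetSum _ fun i _ => measurable_const.indicator (hA i)]
    refine Finset.sum_congr rfl fun i _ => ?_
    rw [lintegral_indicator_const (hA i), mul_comm]
  simp only [h1, expNeg_sum]
  have hi : iIndepFun (fun i ω => expNeg (a i * pointCount X (A i) ω)) μ :=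
    (hX.indep k A hA hdis).comp (fun i t => expNeg (a i * t)) fun i => by fun_prop
  rw [lintegral_prod_eq_prod_lintegral_of_indepFun Finset.univ _ hi fun i => by
    have := hX.measurable_pointCount (hA i)
    fun_prop]
  simp only [hX.lintegral_expNeg_mul_pointCount hd (hA _) (hA' _)]
  rw [← expNeg_sum, h2, Finset.mul_sum]

/-- The Laplace functional of a homogeneous Poisson process. -/
lemma IsPoissonProcess.lintegral_expNeg_tsum (hX : IsPoissonProcess μ X d) (hd : 0 ≤ d)
    {w : Plane → ℝ≥0∞} (hw : Measurable w) :
    ∫⁻ ω, expNeg (∑' n, w (X n ω)) ∂μ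
      = expNeg (ENNReal.ofReal d * ∫⁻ x, (1 - expNeg (w x))) := by
  -- Simple approximations cut off to balls of radius `k`: the cut-off gives finite area, and the
  -- sequence still increases to `w`.
  set v : ℕ → Plane → ℝ≥0∞ := fun k =>
    (Metric.ball (0 : Plane) k).indicator (SimpleFunc.eapprox w k) with hv
  have hvm : ∀ k, Measurable (v k) := fun k =>
    (SimpleFunc.measurable _).indicator measurableSet_ball
  have hmono : Monotone v := by
    intro i j hij x
    simp only [hv]
    by_cases hx : x ∈ Metric.ball (0 : Plane) i
    · have hx' : x ∈ Metric.ball (0 : Plane) j :=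
        Metric.ball_subset_ball (by exact_mod_cast hij) hx
      rw [Set.indicator_of_mem hx, Set.indicator_of_mem hx']
      exact SimpleFunc.monotone_eapprox w hij x
    · rw [Set.indicator_of_notMem hx]
      exact zero_le
  have hlim : ∀ x, Tendsto (fun k => v k x) atTop (𝓝 (w x)) := by
    intro x
    refine (SimpleFunc.tendsto_eapprox hw x).congr' ?_
    obtain ⟨m, hm⟩ := exists_nat_gt ‖x‖
    filter_upwards [eventually_ge_atTop m] with k hk
    have hx : x ∈ Metric.ball (0 : Plane) k := by
      rw [mem_ball_zero_iff]
      exact hm.trans_le (by exact_mod_cast hk)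
    simp only [hv, Set.indicator_of_mem hx]
  have hsum : ∀ ω, Tendsto (fun k => ∑' n, v k (X n ω)) atTop (𝓝 (∑' n, w (X n ω))) := by
    intro ω
    have h := lintegral_tendsto_of_tendsto_of_monotone (μ := (Measure.count : Measure ℕ))
      (f := fun k n => v k (X n ω)) (F := fun n => w (X n ω))
      (fun k => (measurable_of_countable _).aemeasurable)
      (.of_forall fun n i j hij => hmono hij _) (.of_forall fun n => hlim _)
    simpa only [lintegral_count] using h
  have h1 : Tendsto (fun k => ∫⁻ ω, expNeg (∑' n, v k (X n ω)) ∂μ) atTop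
      (𝓝 (∫⁻ ω, expNeg (∑' n, w (X n ω)) ∂μ)) := by
    refine tendsto_lintegral_of_dominated_convergence (fun _ => 1) (fun k => ?_)
      (fun k => .of_forall fun ω => expNeg_le_one _) (by simp)
      (.of_forall fun ω => (continuous_expNeg.tendsto _).comp (hsum ω))
    exact measurable_expNeg.comp (Measurable.tsum fun n => (hvm k).comp (hX.measurable n))
  have h2 : Tendsto (fun k => expNeg (ENNReal.ofReal d * ∫⁻ x, (1 - expNeg (v k x)))) atTop
      (𝓝 (expNeg (ENNReal.ofReal d * ∫⁻ x, (1 - expNeg (w x))))) := by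
    refine (continuous_expNeg.tendsto _).comp ?_
    refine ENNReal.Tendsto.const_mul ?_ (Or.inr ENNReal.ofReal_ne_top)
    refine lintegral_tendsto_of_tendsto_of_monotone (fun k => ?_) (.of_forall fun x i j hij => ?_)
      (.of_forall fun x => ?_)
    · have := hvm k
      exact Measurable.aemeasurable (by fun_prop)
    · exact tsub_le_tsub_left (expNeg_antitone (hmono hij x)) 1
    · exact ENNReal.Tendsto.sub tendsto_const_nhds
        ((continuous_expNeg.tendsto _).comp (hlim x)) (Or.inl ENNReal.one_ne_top)
  refine tendsto_nhds_unique h1 (h2.congr fun k => ?_)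
  exact (hX.lintegral_expNeg_simple hd _ measurableSet_ball measure_ball_lt_top.ne).symm

end PoissonProcess

/-! ### Campbell's formula by differentiation of the Laplace functional -/

lemma one_sub_expNeg_le (t : ℝ≥0∞) : 1 - expNeg t ≤ t := by
  by_cases ht : t = ∞
  · simp [ht]
  have h0 := ENNReal.toReal_nonneg (a := t)
  rw [← ENNReal.ofReal_toReal ht, expNeg_ofReal h0, ← ENNReal.ofReal_one,
    ← ENNReal.ofReal_sub _ (Real.exp_pos _).le]
  refine ENNReal.ofReal_le_ofReal ?_
  linarith [Real.add_one_le_exp (-t.toReal)]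

/-- Derivatives at 0 are taken along the sequence `1 / (k + 1)`, so that Fatou's lemma is available.
-/
lemma tendsto_succ_mul_of_hasDerivAt {f : ℝ → ℝ} {c : ℝ} (hf : HasDerivAt f c 0) (h0 : f 0 = 0) :
    Tendsto (fun k : ℕ => ((k : ℝ) + 1) * f (((k : ℝ) + 1)⁻¹)) atTop (𝓝 c) := by
  have h := hf.tendsto_slope_zero_right
  have hk : Tendsto (fun k : ℕ => ((k : ℝ) + 1)⁻¹) atTop (𝓝[>] 0) := by
    refine tendsto_inv_atTop_nhdsGT_zero.comp ?_
    exact tendsto_natCast_atTop_atTop.atTop_add tendsto_const_nhds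
  refine (h.comp hk).congr fun k => ?_
  simp [h0]

lemma tendsto_succ_mul_one_sub_expNeg (N : ℝ≥0∞) :
    Tendsto (fun k : ℕ => ((k : ℝ≥0∞) + 1) * (1 - expNeg (((k : ℝ≥0∞) + 1)⁻¹ * N))) atTop
      (𝓝 N) := by
  have hk : ∀ k : ℕ, ((k : ℝ≥0∞) + 1) = ENNReal.ofReal ((k : ℝ) + 1) := fun k => by
    rw [ENNReal.ofReal_add (by positivity) zero_le_one]; simp
  by_cases hN : N = ∞
  · subst hN
    have : ∀ k : ℕ, ((k : ℝ≥0∞) + 1) * (1 - expNeg (((k : ℝ≥0∞) + 1)⁻¹ * ∞)) = (k + 1 : ℕ) := by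
      intro k
      rw [ENNReal.mul_top (by simp [ENNReal.add_eq_top])]
      simp
    simp only [this]
    exact ENNReal.tendsto_nat_nhds_top.comp (tendsto_add_atTop_nat 1)
  obtain ⟨c, hc, rfl⟩ : ∃ c : ℝ, 0 ≤ c ∧ N = ENNReal.ofReal c :=
    ⟨N.toReal, ENNReal.toReal_nonneg, (ENNReal.ofReal_toReal hN).symm⟩
  have hd : HasDerivAt (fun t : ℝ => 1 - Real.exp (-(t * c))) c 0 := by
    have h := ((((hasDerivAt_id (0 : ℝ)).mul_const c).neg).exp).const_sub 1
    simpa using h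
  refine (ENNReal.tendsto_ofReal (tendsto_succ_mul_of_hasDerivAt hd (by simp))).congr fun k => ?_
  have hk' : (0 : ℝ) < (k : ℝ) + 1 := by positivity
  rw [hk, ← ENNReal.ofReal_inv_of_pos hk', ← ENNReal.ofReal_mul (by positivity),
    expNeg_ofReal (by positivity), ENNReal.ofReal_mul hk'.le,
    ENNReal.ofReal_sub _ (Real.exp_pos _).le, ENNReal.ofReal_one]

lemma tendsto_succ_mul_one_sub_expNeg_mul_one_sub {c : ℝ≥0∞} (hc : c ≠ ∞) :
    Tendsto (fun k : ℕ => ((k : ℝ≥0∞) + 1) *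
      (1 - expNeg (c * (1 - expNeg (((k : ℝ≥0∞) + 1)⁻¹))))) atTop (𝓝 c) := by
  have hk : ∀ k : ℕ, ((k : ℝ≥0∞) + 1) = ENNReal.ofReal ((k : ℝ) + 1) := fun k => by
    rw [ENNReal.ofReal_add (by positivity) zero_le_one]; simp
  obtain ⟨c, hc0, rfl⟩ : ∃ x : ℝ, 0 ≤ x ∧ c = ENNReal.ofReal x :=
    ⟨c.toReal, ENNReal.toReal_nonneg, (ENNReal.ofReal_toReal hc).symm⟩
  have hd : HasDerivAt (fun t : ℝ => 1 - Real.exp (-(c * (1 - Real.exp (-t))))) c 0 := by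
    have h := (((((hasDerivAt_id (0 : ℝ)).neg.exp).const_sub 1).const_mul c).neg.exp).const_sub 1
    simpa using h
  refine (ENNReal.tendsto_ofReal (tendsto_succ_mul_of_hasDerivAt hd (by simp))).congr fun k => ?_
  have hk' : (0 : ℝ) < (k : ℝ) + 1 := by positivity
  have h1 : Real.exp (-((k : ℝ) + 1)⁻¹) ≤ 1 := Real.exp_le_one_iff.2 (by simp; positivity)
  rw [hk, ← ENNReal.ofReal_inv_of_pos hk', expNeg_ofReal (by positivity), ← ENNReal.ofReal_one,
    ← ENNReal.ofReal_sub _ (Real.exp_pos _).le, ← ENNReal.ofReal_mul hc0,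
    expNeg_ofReal (mul_nonneg hc0 (by linarith)), ← ENNReal.ofReal_sub _ (Real.exp_pos _).le,
    ← ENNReal.ofReal_mul hk'.le]

section PoissonProcess

variable {Ω : Type*} [MeasurableSpace Ω] {μ : Measure Ω} [IsProbabilityMeasure μ]
  {X : ℕ → Ω → Plane} {d : ℝ}

/-- This is minus the derivative at `t = 0` of the Laplace functional of `w + t 1_A`. On the left it
brings down the number of points in `A`, on the right the integral of `expNeg w` over `A`. -/
lemma IsPoissonProcess.lintegral_pointCount_mul_expNeg (hX : IsPoissonProcess μ X d) (hd : 0 ≤ d)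
    {w : Plane → ℝ≥0∞} (hw : Measurable w) {A : Set Plane} (hA : MeasurableSet A)
    (hA' : volume A ≠ ∞) :
    ∫⁻ ω, pointCount X A ω * expNeg (∑' n, w (X n ω)) ∂μ
      = ENNReal.ofReal d * (∫⁻ x in A, expNeg (w x)) *
        expNeg (ENNReal.ofReal d * ∫⁻ x, (1 - expNeg (w x))) := by
  set E : Ω → ℝ≥0∞ := fun ω => expNeg (∑' n, w (X n ω)) with hE
  set N := pointCount X A with hNdef
  set K := ENNReal.ofReal d * ∫⁻ x, (1 - expNeg (w x)) with hK
  set q := ∫⁻ x in A, expNeg (w x) with hq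
  have hNm : Measurable N := hX.measurable_pointCount hA
  have hEm : Measurable E :=
    measurable_expNeg.comp (Measurable.tsum fun n => hw.comp (hX.measurable n))
  have hqtop : q ≠ ∞ := by
    refine ne_top_of_le_ne_top hA' ?_
    calc q ≤ ∫⁻ _ in A, 1 := lintegral_mono fun x => expNeg_le_one _
      _ = volume A := by simp
  have hEint : ∫⁻ ω, E ω ∂μ = expNeg K := hX.lintegral_expNeg_tsum hd hw
  have hint : ∀ t : ℝ≥0∞, ∫⁻ ω, E ω * (1 - expNeg (t * N ω)) ∂μ
      = expNeg K * (1 - expNeg (ENNReal.ofReal d * q * (1 - expNeg t))) := by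
    intro t
    have hwt : Measurable fun x => w x + A.indicator (fun _ => t) x :=
      hw.add (measurable_const.indicator hA)
    have h1 := hX.lintegral_expNeg_tsum hd hwt
    have h2 : ∀ ω, expNeg (∑' n, (w (X n ω) + A.indicator (fun _ => t) (X n ω)))
        = E ω * expNeg (t * N ω) := fun ω => by
      rw [ENNReal.tsum_add, expNeg_add, tsum_indicator_const_eq]
    have h3 : ∀ x, 1 - expNeg (w x + A.indicator (fun _ => t) x)
        = (1 - expNeg (w x)) + A.indicator (fun x => expNeg (w x)) x * (1 - expNeg t) := by
      intro x
      by_cases hx : x ∈ A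
      · rw [Set.indicator_of_mem hx, Set.indicator_of_mem hx, expNeg_add,
          ENNReal.mul_sub fun _ _ => expNeg_ne_top _, mul_one,
          tsub_add_tsub_cancel (expNeg_le_one _) (mul_le_of_le_one_right' (expNeg_le_one _))]
      · simp [Set.indicator_of_notMem hx]
    simp only [h2, h3] at h1
    rw [lintegral_add_left (by fun_prop), lintegral_mul_const _ (by fun_prop (disch := assumption)),
      lintegral_indicator hA, mul_add, expNeg_add, ← mul_assoc] at h1
    calc ∫⁻ ω, E ω * (1 - expNeg (t * N ω)) ∂μ
        = ∫⁻ ω, (E ω - E ω * expNeg (t * N ω)) ∂μ := by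
          refine lintegral_congr fun ω => ?_
          rw [ENNReal.mul_sub fun _ _ => expNeg_ne_top _, mul_one]
      _ = expNeg K - expNeg K * expNeg (ENNReal.ofReal d * q * (1 - expNeg t)) := by
          rw [lintegral_sub (by fun_prop), h1, hEint]
          · rw [h1]
            exact ENNReal.mul_ne_top (expNeg_ne_top _) (expNeg_ne_top _)
          · exact .of_forall fun ω => mul_le_of_le_one_right' (expNeg_le_one _)
      _ = _ := by rw [ENNReal.mul_sub fun _ _ => expNeg_ne_top _, mul_one]
  set F : ℕ → Ω → ℝ≥0∞ := fun k ω =>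
    E ω * (((k : ℝ≥0∞) + 1) * (1 - expNeg (((k : ℝ≥0∞) + 1)⁻¹ * N ω))) with hF
  have hFm : ∀ k, Measurable (F k) := fun k => by fun_prop
  have hFint : ∀ k : ℕ, ∫⁻ ω, F k ω ∂μ = expNeg K * (((k : ℝ≥0∞) + 1) *
      (1 - expNeg (ENNReal.ofReal d * q * (1 - expNeg (((k : ℝ≥0∞) + 1)⁻¹))))) := by
    intro k
    rw [mul_left_comm, ← hint, ← lintegral_const_mul _ (by fun_prop)]
    exact lintegral_congr fun ω => mul_left_comm _ _ _
  have hlimF : Tendsto (fun k => ∫⁻ ω, F k ω ∂μ) atTop (𝓝 (expNeg K * (ENNReal.ofReal d * q))) := by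
    simp only [hFint]
    exact ENNReal.Tendsto.const_mul (tendsto_succ_mul_one_sub_expNeg_mul_one_sub
      (ENNReal.mul_ne_top ENNReal.ofReal_ne_top hqtop)) (Or.inr (expNeg_ne_top _))
  have hlim : ∀ ω, Tendsto (fun k => F k ω) atTop (𝓝 (N ω * E ω)) := fun ω => by
    rw [mul_comm]
    exact ENNReal.Tendsto.const_mul (tendsto_succ_mul_one_sub_expNeg _) (Or.inr (expNeg_ne_top _))
  have hle : ∀ k ω, F k ω ≤ N ω * E ω := by
    intro k ω
    rw [mul_comm (N ω)]
    refine mul_le_mul_right ?_ _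
    calc ((k : ℝ≥0∞) + 1) * (1 - expNeg (((k : ℝ≥0∞) + 1)⁻¹ * N ω))
        ≤ ((k : ℝ≥0∞) + 1) * (((k : ℝ≥0∞) + 1)⁻¹ * N ω) := by
          gcongr; exact one_sub_expNeg_le _
      _ = N ω := ENNReal.mul_inv_cancel_left (by simp) (by simp [ENNReal.add_eq_top])
  -- The difference quotients `F k` converge pointwise to `N * E` and stay below it, since `1 -
  -- expNeg t ≤ t`. Fatou gives one inequality and monotonicity of the integral the other.
  rw [mul_comm _ (expNeg K)]
  refine le_antisymm ?_ (le_of_tendsto' hlimF fun k => lintegral_mono (hle k))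
  calc ∫⁻ ω, N ω * E ω ∂μ = ∫⁻ ω, liminf (fun k => F k ω) atTop ∂μ :=
        lintegral_congr fun ω => (hlim ω).liminf_eq.symm
    _ ≤ liminf (fun k => ∫⁻ ω, F k ω ∂μ) atTop := lintegral_liminf_le hFm
    _ = _ := hlimF.liminf_eq

/-- Both sides are integrals of `f` against measures on the plane. The measures agree on sets of
finite area by the preceding lemma, hence everywhere by σ-finiteness. -/
lemma IsPoissonProcess.lintegral_tsum_mul_expNeg (hX : IsPoissonProcess μ X d) (hd : 0 ≤ d)
    {w : Plane → ℝ≥0∞} (hw : Measurable w) {f : Plane → ℝ≥0∞} (hf : Measurable f) :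
    ∫⁻ ω, ∑' n, f (X n ω) * expNeg (∑' m, w (X m ω)) ∂μ
      = ENNReal.ofReal d * (∫⁻ x, expNeg (w x) * f x) *
        expNeg (ENNReal.ofReal d * ∫⁻ x, (1 - expNeg (w x))) := by
  set E : Ω → ℝ≥0∞ := fun ω => expNeg (∑' n, w (X n ω)) with hE
  set K := ENNReal.ofReal d * ∫⁻ x, (1 - expNeg (w x)) with hK
  have hEm : Measurable E :=
    measurable_expNeg.comp (Measurable.tsum fun n => hw.comp (hX.measurable n))
  have hwm : Measurable fun x => expNeg (w x) := measurable_expNeg.comp hw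
  set M₁ : Measure Plane := Measure.sum fun n => (μ.withDensity E).map (X n)
  set M₂ : Measure Plane := (ENNReal.ofReal d * expNeg K) • volume.withDensity fun x => expNeg (w x)
  have hM₁ : ∀ g : Plane → ℝ≥0∞, Measurable g →
      ∫⁻ x, g x ∂M₁ = ∫⁻ ω, ∑' n, g (X n ω) * E ω ∂μ := by
    intro g hg
    rw [lintegral_sum_measure, lintegral_tsum (f := fun n ω => g (X n ω) * E ω) fun n =>
      ((hg.comp (hX.measurable n)).mul hEm).aemeasurable]
    refine tsum_congr fun n => ?_
    rw [lintegral_map hg (hX.measurable n), lintegral_withDensity_eq_lintegral_mul _ hEm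
      (g := fun ω => g (X n ω)) (hg.comp (hX.measurable n))]
    exact lintegral_congr fun ω => mul_comm _ _
  have hfin : ∀ A, MeasurableSet A → volume A ≠ ∞ → M₁ A = M₂ A := by
    intro A hA hA'
    rw [← lintegral_indicator_one hA, hM₁ _ (measurable_one.indicator hA)]
    have h := hX.lintegral_pointCount_mul_expNeg hd hw hA hA'
    rw [Measure.smul_apply, withDensity_apply _ hA, smul_eq_mul, mul_right_comm, ← h]
    refine lintegral_congr fun ω => ?_
    rw [ENNReal.tsum_mul_right]
    rfl
  have hM : M₁ = M₂ := by
    refine Measure.ext_of_iUnion_eq_univ (iUnion_spanningSets (volume : Measure Plane)) fun i => ?_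
    refine Measure.ext fun A hA => ?_
    rw [Measure.restrict_apply hA, Measure.restrict_apply hA]
    refine hfin _ (hA.inter (measurableSet_spanningSets _ _)) ?_
    exact ne_top_of_le_ne_top (measure_spanningSets_lt_top _ _).ne
      (measure_mono Set.inter_subset_right)
  rw [← hM₁ f hf, hM, lintegral_smul_measure, smul_eq_mul,
    lintegral_withDensity_eq_lintegral_mul _ hwm hf, mul_right_comm]
  rfl

/-- The reduced Campbell formula for an exponential functional of the other points. -/
lemma IsPoissonProcess.lintegral_tsum_indicator_mul_expNeg (hX : IsPoissonProcess μ X d)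
    (hd : 0 ≤ d) {w : Plane → ℝ≥0∞} (hw : Measurable w) (hw' : ∀ x, w x ≠ ∞) {A : Set Plane}
    (hA : MeasurableSet A) :
    ∫⁻ ω, ∑' n, A.indicator 1 (X n ω) * expNeg (∑' m, if m = n then 0 else w (X m ω)) ∂μ
      = ENNReal.ofReal d * volume A *
        expNeg (ENNReal.ofReal d * ∫⁻ x, (1 - expNeg (w x))) := by
  have hwm : Measurable fun x => expNeg (w x) := measurable_expNeg.comp hw
  -- Dividing by `expNeg (w x)` cancels the factor of the point itself, leaving only the other
  -- points in the exponent. Finiteness of `w` makes the division legitimate.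
  have h := hX.lintegral_tsum_mul_expNeg hd hw (f := fun x => A.indicator 1 x * (expNeg (w x))⁻¹)
    ((measurable_one.indicator hA).mul hwm.inv)
  have h1 : ∀ x, expNeg (w x) * (A.indicator 1 x * (expNeg (w x))⁻¹) = A.indicator 1 x := fun x => by
    rw [mul_left_comm, ENNReal.mul_inv_cancel (expNeg_ne_zero (hw' x)) (expNeg_ne_top _), mul_one]
  simp only [h1] at h
  rw [lintegral_indicator_one hA] at h
  rw [← h]
  refine lintegral_congr fun ω => tsum_congr fun n => ?_
  rw [ENNReal.tsum_eq_add_tsum_ite (f := fun m => w (X m ω)) n, expNeg_add, mul_assoc,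
    ENNReal.inv_mul_cancel_left (expNeg_ne_zero (hw' _)) (expNeg_ne_top _)]
  congr!

end PoissonProcess

/-! ### Replacing a frozen distance by the distance of the point -/

section Radial

/-- The annulus `θ ^ j ≤ ‖x‖ < θ ^ (j + 1)`. -/
def annulus (θ : ℝ) (j : ℤ) : Set Plane := {x | ‖x‖ ∈ Set.Ico (θ ^ j) (θ ^ (j + 1))}

lemma measurableSet_annulus (θ : ℝ) (j : ℤ) : MeasurableSet (annulus θ j) :=
  measurable_norm measurableSet_Ico

lemma tsum_indicator_annulus {θ : ℝ} (hθ : 1 < θ) {x : Plane} {j : ℤ} (hj : x ∈ annulus θ j)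
    (u : ℤ → ℝ≥0∞) : ∑' i, (annulus θ i).indicator 1 x * u i = u j := by
  rw [tsum_eq_single j, Set.indicator_of_mem hj, Pi.one_apply, one_mul]
  intro i hij
  rw [Set.indicator_of_notMem, zero_mul]
  intro hi
  have h1 : j < i + 1 := (zpow_lt_zpow_iff_right₀ hθ).1 (hj.1.trans_lt hi.2)
  have h2 : i < j + 1 := (zpow_lt_zpow_iff_right₀ hθ).1 (hi.1.trans_lt hj.2)
  omega

lemma exists_mem_annulus {θ : ℝ} (hθ : 1 < θ) {x : Plane} (hx : x ≠ 0) : ∃ j, x ∈ annulus θ j :=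
  exists_mem_Ico_zpow (norm_pos_iff.2 hx) hθ

lemma lintegral_norm_mul {Φ : ℝ → ℝ≥0∞} (hΦ : Measurable Φ) {s : ℝ} (hs : 0 < s) :
    ∫⁻ x : Plane, Φ (s * ‖x‖) = ENNReal.ofReal ((s ^ 2)⁻¹) * ∫⁻ x : Plane, Φ ‖x‖ := by
  have h := Measure.map_addHaar_smul (volume : Measure Plane) hs.ne'
  have h1 : ∫⁻ x : Plane, Φ ‖x‖ ∂(Measure.map (s • ·) volume) = ∫⁻ x : Plane, Φ (s * ‖x‖) := by
    rw [lintegral_map (f := fun x : Plane => Φ ‖x‖) (hΦ.comp measurable_norm)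
      (measurable_const_smul s)]
    simp only [norm_smul, Real.norm_eq_abs, abs_of_pos hs]
  rw [← h1, h, lintegral_smul_measure, smul_eq_mul, finrank_euclideanSpace, Fintype.card_fin,
    abs_of_pos (by positivity)]

lemma ae_ne_zero_plane : ∀ᵐ x : Plane, x ≠ 0 :=
  compl_mem_ae_iff.2 (measure_singleton (0 : Plane))

variable {Ω : Type*} [MeasurableSpace Ω] {μ : Measure Ω}

/-- If for each fixed parameter `r` the points of `X`, weighted by `G r n`, have constant intensity
`c * Φ r`, and `G` decreases in `r`, then the parameter may be taken to be the distance of the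
point itself. -/
lemma lintegral_tsum_norm {X : ℕ → Ω → Plane} (hX : ∀ n, Measurable (X n))
    (h0 : ∀ n, ∀ᵐ ω ∂μ, X n ω ≠ 0) {G : ℝ → ℕ → Ω → ℝ≥0∞} (hG : ∀ r n, Measurable (G r n))
    (hanti : ∀ r s, 0 < r → r ≤ s → ∀ n ω, G s n ω ≤ G r n ω) {Φ : ℝ → ℝ≥0∞}
    (hΦ : AntitoneOn Φ (Set.Ioi 0)) (hΦm : Measurable Φ) {c : ℝ≥0∞}
    (h : ∀ r, 0 < r → ∀ A : Set Plane, MeasurableSet A →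
      ∫⁻ ω, ∑' n, A.indicator 1 (X n ω) * G r n ω ∂μ = c * volume A * Φ r) :
    ∫⁻ ω, ∑' n, G ‖X n ω‖ n ω ∂μ = c * ∫⁻ x : Plane, Φ ‖x‖ := by
  have h0' : ∀ᵐ ω ∂μ, ∀ n, X n ω ≠ 0 := ae_all_iff.2 h0
  -- For radii constant on each annulus, the hypothesis `h` applies annulus by annulus, and the
  -- identity is exact.
  have key : ∀ θ : ℝ, 1 < θ → ∀ v : ℤ → ℝ, (∀ j, 0 < v j) →
      ∫⁻ ω, ∑' n, ∑' j, (annulus θ j).indicator 1 (X n ω) * G (v j) n ω ∂μ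
        = c * ∫⁻ x, ∑' j, (annulus θ j).indicator 1 x * Φ (v j) := by
    intro θ hθ v hv
    have hi : ∀ j, Measurable ((annulus θ j).indicator (1 : Plane → ℝ≥0∞)) := fun j =>
      measurable_one.indicator (measurableSet_annulus θ j)
    simp only [fun ω => ENNReal.tsum_comm (f := fun n j =>
      (annulus θ j).indicator (1 : Plane → ℝ≥0∞) (X n ω) * G (v j) n ω)]
    rw [lintegral_tsum (f := fun j ω => ∑' n, (annulus θ j).indicator (1 : Plane → ℝ≥0∞) (X n ω) *
      G (v j) n ω) fun j => (Measurable.tsum fun n =>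
      ((hi j).comp (hX n)).mul (hG _ n)).aemeasurable,
      lintegral_tsum fun j => ((hi j).mul_const _).aemeasurable, ← ENNReal.tsum_mul_left]
    refine tsum_congr fun j => ?_
    refine (h (v j) (hv j) _ (measurableSet_annulus θ j)).trans ?_
    rw [lintegral_mul_const _ (hi j), lintegral_indicator_one (measurableSet_annulus θ j), mul_assoc]
  set T := ∫⁻ ω, ∑' n, G ‖X n ω‖ n ω ∂μ with hT
  set J := c * ∫⁻ x : Plane, Φ ‖x‖ with hJ
  -- Rounding the distance down to `θ ^ j` increases `G`. On the other side `θ⁻¹ * ‖x‖ ≤ θ ^ j`, and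
  -- rescaling the plane costs the factor `θ ^ 2`.
  have upper : ∀ θ : ℝ, 1 < θ → T ≤ ENNReal.ofReal (θ ^ 2) * J := by
    intro θ hθ
    have hθ0 : 0 < θ := one_pos.trans hθ
    calc T ≤ ∫⁻ ω, ∑' n, ∑' j, (annulus θ j).indicator 1 (X n ω) * G (θ ^ j) n ω ∂μ := by
          refine lintegral_mono_ae (h0'.mono fun ω hω => ENNReal.tsum_le_tsum fun n => ?_)
          obtain ⟨j, hj⟩ := exists_mem_annulus hθ (hω n)
          rw [tsum_indicator_annulus hθ hj fun j => G (θ ^ j) n ω]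
          exact hanti _ _ (zpow_pos hθ0 j) hj.1 n ω
      _ = c * ∫⁻ x, ∑' j, (annulus θ j).indicator 1 x * Φ (θ ^ j) :=
          key θ hθ _ fun j => zpow_pos hθ0 j
      _ ≤ c * ∫⁻ x : Plane, Φ (θ⁻¹ * ‖x‖) := by
          refine mul_le_mul_right ?_ c
          refine lintegral_mono_ae (ae_ne_zero_plane.mono fun x hx => ?_)
          obtain ⟨j, hj⟩ := exists_mem_annulus hθ hx
          rw [tsum_indicator_annulus hθ hj fun j => Φ (θ ^ j)]
          have hx' := norm_pos_iff.2 hx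
          refine hΦ (Set.mem_Ioi.2 (by positivity)) (zpow_pos hθ0 j) ?_
          rw [inv_mul_le_iff₀ hθ0, mul_comm, ← zpow_add_one₀ hθ0.ne']
          exact hj.2.le
      _ = ENNReal.ofReal (θ ^ 2) * J := by
          rw [lintegral_norm_mul hΦm (inv_pos.2 hθ0), inv_pow, inv_inv, mul_left_comm]
  -- Symmetrically, the distance is rounded up to `θ ^ (j + 1)`, which is at most `θ * ‖x‖`.
  have lower : ∀ θ : ℝ, 1 < θ → ENNReal.ofReal ((θ ^ 2)⁻¹) * J ≤ T := by
    intro θ hθ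
    have hθ0 : 0 < θ := one_pos.trans hθ
    calc ENNReal.ofReal ((θ ^ 2)⁻¹) * J = c * ∫⁻ x : Plane, Φ (θ * ‖x‖) := by
          rw [lintegral_norm_mul hΦm hθ0, mul_left_comm]
      _ ≤ c * ∫⁻ x, ∑' j, (annulus θ j).indicator 1 x * Φ (θ ^ (j + 1)) := by
          refine mul_le_mul_right ?_ c
          refine lintegral_mono_ae (ae_ne_zero_plane.mono fun x hx => ?_)
          obtain ⟨j, hj⟩ := exists_mem_annulus hθ hx
          rw [tsum_indicator_annulus hθ hj fun j => Φ (θ ^ (j + 1))]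
          have hx' := norm_pos_iff.2 hx
          refine hΦ (zpow_pos hθ0 _) (Set.mem_Ioi.2 (by positivity)) ?_
          rw [zpow_add_one₀ hθ0.ne', mul_comm]
          exact mul_le_mul_of_nonneg_left hj.1 hθ0.le
      _ = ∫⁻ ω, ∑' n, ∑' j, (annulus θ j).indicator 1 (X n ω) * G (θ ^ (j + 1)) n ω ∂μ :=
          (key θ hθ _ fun j => zpow_pos hθ0 _).symm
      _ ≤ T := by
          refine lintegral_mono_ae (h0'.mono fun ω hω => ENNReal.tsum_le_tsum fun n => ?_)
          obtain ⟨j, hj⟩ := exists_mem_annulus hθ (hω n)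
          rw [tsum_indicator_annulus hθ hj fun j => G (θ ^ (j + 1)) n ω]
          exact hanti _ _ (norm_pos_iff.2 (hω n)) hj.2.le n ω
  have lim1 : Tendsto (fun θ : ℝ => ENNReal.ofReal (θ ^ 2) * J) (𝓝[>] 1) (𝓝 J) := by
    have h1 : Tendsto (fun θ : ℝ => ENNReal.ofReal (θ ^ 2)) (𝓝[>] 1) (𝓝 1) := by
      have : Continuous fun θ : ℝ => ENNReal.ofReal (θ ^ 2) :=
        ENNReal.continuous_ofReal.comp (continuous_pow 2)
      simpa using (this.tendsto 1).mono_left nhdsWithin_le_nhds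
    simpa using ENNReal.Tendsto.mul_const (b := J) h1 (Or.inl one_ne_zero)
  have lim2 : Tendsto (fun θ : ℝ => ENNReal.ofReal ((θ ^ 2)⁻¹) * J) (𝓝[>] 1) (𝓝 J) := by
    have h1 : Tendsto (fun θ : ℝ => ENNReal.ofReal ((θ ^ 2)⁻¹)) (𝓝[>] 1) (𝓝 1) := by
      have h2 : Tendsto (fun θ : ℝ => (θ ^ 2)⁻¹) (𝓝 1) (𝓝 1) := by
        have h3 : Tendsto (fun θ : ℝ => θ ^ 2) (𝓝 1) (𝓝 1) := by
          simpa using (continuous_pow 2).tendsto (1 : ℝ)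
        simpa using h3.inv₀ one_ne_zero
      simpa using ENNReal.tendsto_ofReal (h2.mono_left nhdsWithin_le_nhds)
    simpa using ENNReal.Tendsto.mul_const (b := J) h1 (Or.inl one_ne_zero)
  exact le_antisymm (ge_of_tendsto lim1 (eventually_mem_nhdsWithin.mono upper))
    (le_of_tendsto lim2 (eventually_mem_nhdsWithin.mono lower))

end Radial

/-! ### Plane integrals of the path loss -/

section PathLoss

/-- The Bochner integral of a non-integrable function is 0 by convention, so a positive value
already proves integrability. -/
lemma lintegral_ofReal_eq_of_integral_eq {E : Type*} [MeasurableSpace E] {ν : Measure E}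
    {f : E → ℝ} {c : ℝ} (hf : 0 ≤ᵐ[ν] f) (h : ∫ x, f x ∂ν = c) (hc : 0 < c) :
    ∫⁻ x, ENNReal.ofReal (f x) ∂ν = ENNReal.ofReal c := by
  have hi : Integrable f ν := by
    by_contra hi
    rw [integral_undef hi] at h
    exact hc.ne h
  rw [← ofReal_integral_eq_lintegral_ofReal hi hf, h]

lemma lintegral_exp_neg_mul_norm_rpow {α t : ℝ} (hα : 0 < α) (ht : 0 < t) :
    ∫⁻ x : Plane, ENNReal.ofReal (Real.exp (-(t * ‖x‖ ^ α)))
      = ENNReal.ofReal (2 * Real.pi / α * Real.Gamma (2 / α) * t ^ (-(2 / α))) := by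
  have hΓ : 0 < Real.Gamma (2 / α) := Real.Gamma_pos_of_pos (by positivity)
  refine lintegral_ofReal_eq_of_integral_eq (.of_forall fun x => (Real.exp_pos _).le) ?_
    (by positivity)
  rw [integral_fun_norm_addHaar volume fun r => Real.exp (-(t * r ^ α))]
  have h := integral_rpow_mul_exp_neg_mul_rpow hα (by norm_num : (-1 : ℝ) < 1) ht
  have hb : volume.real (Metric.ball (0 : Plane) 1) = Real.pi := by
    rw [Measure.real, EuclideanSpace.volume_ball_fin_two]
    simp [Real.pi_pos.le]
  simp only [finrank_euclideanSpace, Fintype.card_fin, smul_eq_mul, nsmul_eq_mul, hb]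
  have h2 : ∫ y in Set.Ioi (0 : ℝ), y ^ (2 - 1) * Real.exp (-(t * y ^ α))
      = ∫ y in Set.Ioi (0 : ℝ), y ^ (1 : ℝ) * Real.exp (-t * y ^ α) := by
    refine integral_congr_ae (.of_forall fun y => ?_)
    simp
  rw [h2, h, show (1 : ℝ) + 1 = 2 by norm_num, neg_div]
  push_cast
  ring

lemma lintegral_exp_neg_mul_Ioi {c : ℝ} (hc : 0 < c) :
    ∫⁻ t in Set.Ioi (0 : ℝ), ENNReal.ofReal (Real.exp (-(t * c))) = ENNReal.ofReal c⁻¹ := by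
  refine lintegral_ofReal_eq_of_integral_eq (.of_forall fun x => (Real.exp_pos _).le) ?_
    (by positivity)
  have h := Real.integral_rpow_mul_exp_neg_mul_Ioi one_pos hc
  simpa [mul_comm c] using h

/-- The integral over the plane of the interference factor of a single tier. -/
lemma lintegral_one_sub_inv_one_add_rpow {α s : ℝ} (hα : 2 < α) (hs : 0 ≤ s) :
    ∫⁻ x : Plane, (1 - (1 + ENNReal.ofReal s * ENNReal.ofReal (‖x‖ ^ (-α)))⁻¹)
      = ENNReal.ofReal (Real.pi * s ^ (2 / α) *
          ((2 * Real.pi / α) / Real.sin (2 * Real.pi / α))) := by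
  have hα0 : 0 < α := by linarith
  rcases hs.eq_or_lt with rfl | hs
  · rw [Real.zero_rpow (by positivity)]
    simp
  have ha1 : 2 / α < 1 := (div_lt_one hα0).2 hα
  -- The integrand is `s / (s + ‖x‖ ^ α)`, written as a Laplace integral in `t`. After Tonelli the
  -- plane integral yields `Γ(2/α) t ^ (-2/α)`, the `t` integral yields `Γ(1 - 2/α)` because `2/α <
  -- 1`, and the reflection formula produces the sine.
  have h1 : ∀ x : Plane, x ≠ 0 →
      1 - (1 + ENNReal.ofReal s * ENNReal.ofReal (‖x‖ ^ (-α)))⁻¹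
        = ∫⁻ t in Set.Ioi (0 : ℝ), ENNReal.ofReal (s * Real.exp (-(t * s))) *
            ENNReal.ofReal (Real.exp (-(t * ‖x‖ ^ α))) := by
    intro x hx
    have hx' : 0 < ‖x‖ ^ α := Real.rpow_pos_of_pos (norm_pos_iff.2 hx) α
    have h2 : ∀ t : ℝ, ENNReal.ofReal (s * Real.exp (-(t * s))) *
        ENNReal.ofReal (Real.exp (-(t * ‖x‖ ^ α)))
          = ENNReal.ofReal s * ENNReal.ofReal (Real.exp (-(t * (s + ‖x‖ ^ α)))) := by
      intro t
      rw [ENNReal.ofReal_mul hs.le, mul_assoc, ← ENNReal.ofReal_mul (Real.exp_pos _).le,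
        ← Real.exp_add]
      congr 3; ring
    simp only [h2]
    rw [lintegral_const_mul _ (by fun_prop), lintegral_exp_neg_mul_Ioi (by positivity),
      ← ENNReal.ofReal_mul hs.le, ← ENNReal.ofReal_mul hs.le, ← ENNReal.ofReal_one,
      ← ENNReal.ofReal_add zero_le_one (by positivity), ← ENNReal.ofReal_inv_of_pos (by positivity),
      ← ENNReal.ofReal_sub _ (by positivity), Real.rpow_neg (norm_nonneg x)]
    congr 1
    field_simp
    ring
  have hΓ1 : 0 < Real.Gamma (2 / α) := Real.Gamma_pos_of_pos (by positivity)
  have hΓ2 : 0 < Real.Gamma (1 - 2 / α) := Real.Gamma_pos_of_pos (by linarith)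
  calc ∫⁻ x : Plane, (1 - (1 + ENNReal.ofReal s * ENNReal.ofReal (‖x‖ ^ (-α)))⁻¹)
      = ∫⁻ x : Plane, ∫⁻ t in Set.Ioi (0 : ℝ), ENNReal.ofReal (s * Real.exp (-(t * s))) *
            ENNReal.ofReal (Real.exp (-(t * ‖x‖ ^ α))) :=
        lintegral_congr_ae (ae_ne_zero_plane.mono h1)
    _ = ∫⁻ t in Set.Ioi (0 : ℝ), ∫⁻ x : Plane, ENNReal.ofReal (s * Real.exp (-(t * s))) *
            ENNReal.ofReal (Real.exp (-(t * ‖x‖ ^ α))) :=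
        lintegral_lintegral_swap (Measurable.aemeasurable (by fun_prop))
    _ = ∫⁻ t in Set.Ioi (0 : ℝ), ENNReal.ofReal (s * (2 * Real.pi / α * Real.Gamma (2 / α)) *
          (t ^ ((1 - 2 / α) - 1) * Real.exp (-(s * t)))) := by
        refine setLIntegral_congr_fun measurableSet_Ioi fun t ht => ?_
        have ht0 : (0 : ℝ) < t := ht
        rw [lintegral_const_mul _ (by fun_prop), lintegral_exp_neg_mul_norm_rpow hα0 ht,
          ← ENNReal.ofReal_mul (by positivity)]
        congr 1
        rw [show (1 - 2 / α) - 1 = -(2 / α) by ring, mul_comm t s]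
        ring
    _ = ENNReal.ofReal (s * (2 * Real.pi / α * Real.Gamma (2 / α)) *
          ((1 / s) ^ (1 - 2 / α) * Real.Gamma (1 - 2 / α))) := by
        refine lintegral_ofReal_eq_of_integral_eq ?_ ?_ (by positivity)
        · refine (ae_restrict_mem measurableSet_Ioi).mono fun t ht => ?_
          have ht0 : (0 : ℝ) < t := ht
          simp only [Pi.zero_apply]
          positivity
        · rw [integral_const_mul, Real.integral_rpow_mul_exp_neg_mul_Ioi (by linarith) hs]
    _ = _ := by
        congr 1
        have hrefl := Real.Gamma_mul_Gamma_one_sub (2 / α)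
        have hpow : s * (1 / s) ^ (1 - 2 / α) = s ^ (2 / α) := by
          rw [one_div, Real.inv_rpow hs.le, ← Real.rpow_neg hs.le]
          nth_rewrite 1 [← Real.rpow_one s]
          rw [← Real.rpow_add hs]
          congr 1; ring
        calc s * (2 * Real.pi / α * Real.Gamma (2 / α)) *
              ((1 / s) ^ (1 - 2 / α) * Real.Gamma (1 - 2 / α))
            = (s * (1 / s) ^ (1 - 2 / α)) * (2 * Real.pi / α) *
              (Real.Gamma (2 / α) * Real.Gamma (1 - 2 / α)) := by ring
          _ = _ := by
            rw [hrefl, hpow, show Real.pi * (2 / α) = 2 * Real.pi / α by ring]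
            ring

end PathLoss

/-! ### Mean number of stations that win against the interference -/

section Coverage

/-- The path loss `‖x‖ ^ (-α)`. -/
def pathLoss (α : ℝ) (x : Plane) : ℝ≥0∞ := ENNReal.ofReal (‖x‖ ^ (-α))

@[fun_prop]
lemma measurable_pathLoss (α : ℝ) : Measurable (pathLoss α) := by
  unfold pathLoss
  fun_prop

lemma pathLoss_ne_top (α : ℝ) (x : Plane) : pathLoss α x ≠ ∞ := ENNReal.ofReal_ne_top

lemma lintegral_one_sub_expNeg_logOneAdd {α s : ℝ} (hα : 2 < α) (hs : 0 ≤ s) :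
    ∫⁻ x : Plane, (1 - expNeg (logOneAdd (ENNReal.ofReal s * pathLoss α x)))
      = ENNReal.ofReal (Real.pi * s ^ (2 / α) *
          ((2 * Real.pi / α) / Real.sin (2 * Real.pi / α))) := by
  simp only [expNeg_logOneAdd, pathLoss]
  exact lintegral_one_sub_inv_one_add_rpow hα hs

lemma sinc_two_pi_div_pos {α : ℝ} (hα : 2 < α) :
    0 < (2 * Real.pi / α) / Real.sin (2 * Real.pi / α) := by
  have hπ := Real.pi_pos
  have h1 : 0 < 2 * Real.pi / α := by positivity
  refine div_pos h1 (Real.sin_pos_of_pos_of_lt_pi h1 ?_)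
  rw [div_lt_iff₀ (by linarith)]
  nlinarith

variable {Ω : Type*}

/-- The Laplace transform, given that the station `n` of the process `X` serves at distance `r`, of
the noise and of the interference from the other points of `X` and the points of `Y`. -/
def interferenceFactor (α b c₁ c₂ σ : ℝ) (X Y : ℕ → Ω → Plane) (r : ℝ) (n : ℕ) (ω : Ω) : ℝ≥0∞ :=
  expNeg ((∑' m, if m = n then 0 else logOneAdd (ENNReal.ofReal (b * r ^ α * c₁) *
      pathLoss α (X m ω)))
    + ∑' m, logOneAdd (ENNReal.ofReal (b * r ^ α * c₂) * pathLoss α (Y m ω))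
    + ENNReal.ofReal (b * r ^ α * σ))

lemma interferenceFactor_anti {α b c₁ c₂ σ : ℝ} (hα : 0 ≤ α) (hb : 0 ≤ b) (h₁ : 0 ≤ c₁)
    (h₂ : 0 ≤ c₂) (hσ : 0 ≤ σ) (X Y : ℕ → Ω → Plane) {r s : ℝ} (hr : 0 < r) (hrs : r ≤ s) (n : ℕ)
    (ω : Ω) : interferenceFactor α b c₁ c₂ σ X Y s n ω ≤ interferenceFactor α b c₁ c₂ σ X Y r n ω := by
  have hp : r ^ α ≤ s ^ α := Real.rpow_le_rpow hr.le hrs hα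
  have hm : ∀ c : ℝ, 0 ≤ c → ENNReal.ofReal (b * r ^ α * c) ≤ ENNReal.ofReal (b * s ^ α * c) :=
    fun c hc => ENNReal.ofReal_le_ofReal (by gcongr)
  refine expNeg_antitone (add_le_add (add_le_add (ENNReal.tsum_le_tsum fun m => ?_)
    (ENNReal.tsum_le_tsum fun m => ?_)) (hm σ hσ))
  · split_ifs
    · exact le_rfl
    · exact logOneAdd_mono (mul_le_mul_left (hm _ h₁) _)
  · exact logOneAdd_mono (mul_le_mul_left (hm _ h₂) _)

variable [MeasurableSpace Ω] {μ : Measure Ω}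

lemma measurable_interferenceFactor {α b c₁ c₂ σ : ℝ} {X Y : ℕ → Ω → Plane}
    (hX : ∀ n, Measurable (X n)) (hY : ∀ n, Measurable (Y n)) {r : Ω → ℝ} (hr : Measurable r)
    (n : ℕ) : Measurable fun ω => interferenceFactor α b c₁ c₂ σ X Y (r ω) n ω := by
  unfold interferenceFactor
  refine measurable_expNeg.comp (((Measurable.tsum fun m => ?_).add
    (Measurable.tsum fun m => ?_)).add (by fun_prop))
  · have := hX m
    split_ifs <;> fun_prop
  · have := hY m
    fun_prop

variable [IsProbabilityMeasure μ]

/-- The origin has area 0, so it contains no point with probability `exp 0 = 1`. -/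
lemma IsPoissonProcess.ae_ne_zero {X : ℕ → Ω → Plane} {d : ℝ} (hX : IsPoissonProcess μ X d)
    (n : ℕ) : ∀ᵐ ω ∂μ, X n ω ≠ 0 := by
  have h := hX.law {0} (measurableSet_singleton 0) (by simp) 0
  have h1 : ∀ᵐ ω ∂μ, pointCount X {0} ω = 0 := by
    rw [ae_iff, ← Set.compl_ofPred]
    have hm : MeasurableSet {ω | pointCount X {0} ω = 0} :=
      hX.measurable_pointCount (measurableSet_singleton 0) (measurableSet_singleton 0)
    rw [prob_compl_eq_zero_iff hm]
    simpa [Measure.real] using h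
  filter_upwards [h1] with ω hω h0
  rw [pointCount, ENNReal.tsum_eq_zero] at hω
  simpa [h0] using hω n

/-- With `r` fixed, the integrand splits into a functional of `X`, a functional of `Y` and a
constant noise factor. Independence of `X` and `Y` separates the first two: the reduced Campbell
formula evaluates one, the Laplace functional the other. -/
lemma lintegral_tsum_indicator_mul_interferenceFactor {α b c₁ c₂ σ d₁ d₂ : ℝ} (hα : 2 < α)
    (hb : 0 ≤ b) (h₁ : 0 ≤ c₁) (h₂ : 0 ≤ c₂) (hσ : 0 ≤ σ) (hd₁ : 0 ≤ d₁) (hd₂ : 0 ≤ d₂)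
    {X Y : ℕ → Ω → Plane} (hX : IsPoissonProcess μ X d₁) (hY : IsPoissonProcess μ Y d₂)
    (hXY : IndepFun (fun ω n => X n ω) (fun ω n => Y n ω) μ) {r : ℝ} (hr : 0 < r) {A : Set Plane}
    (hA : MeasurableSet A) :
    ∫⁻ ω, ∑' n, A.indicator 1 (X n ω) * interferenceFactor α b c₁ c₂ σ X Y r n ω ∂μ
      = ENNReal.ofReal d₁ * volume A * ENNReal.ofReal
        (Real.exp (-(Real.pi * r ^ 2 * b ^ (2 / α) * ((2 * Real.pi / α) / Real.sin (2 * Real.pi / α)) *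
          (d₁ * c₁ ^ (2 / α) + d₂ * c₂ ^ (2 / α)))) * Real.exp (-(b * r ^ α * σ))) := by
  set C := (2 * Real.pi / α) / Real.sin (2 * Real.pi / α) with hC
  have hC0 : 0 < C := sinc_two_pi_div_pos hα
  set w : ℝ → Plane → ℝ≥0∞ := fun c x =>
    logOneAdd (ENNReal.ofReal (b * r ^ α * c) * pathLoss α x) with hw
  have hwm : ∀ c, Measurable (w c) := fun c => by simp only [hw]; fun_prop
  have hwt : ∀ c x, w c x ≠ ∞ := fun c x =>
    logOneAdd_ne_top (ENNReal.mul_ne_top ENNReal.ofReal_ne_top (pathLoss_ne_top _ _))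
  have hwi : ∀ c d : ℝ, 0 ≤ c → 0 ≤ d → expNeg (ENNReal.ofReal d * ∫⁻ x, (1 - expNeg (w c x)))
      = ENNReal.ofReal (Real.exp (-(Real.pi * r ^ 2 * b ^ (2 / α) * C * (d * c ^ (2 / α))))) := by
    intro c d hc hd
    have hr2 : (r ^ α) ^ (2 / α) = r ^ 2 := by
      rw [← Real.rpow_mul hr.le, mul_div_cancel₀ _ (by linarith : α ≠ 0)]
      exact_mod_cast Real.rpow_natCast r 2
    rw [lintegral_one_sub_expNeg_logOneAdd hα (by positivity), ← ENNReal.ofReal_mul hd,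
      expNeg_ofReal (by positivity), Real.mul_rpow (by positivity) hc,
      Real.mul_rpow hb (by positivity), hr2]
    congr 3; ring
  set S₁ : (ℕ → Plane) → ℝ≥0∞ := fun x =>
    ∑' n, A.indicator 1 (x n) * expNeg (∑' m, if m = n then 0 else w c₁ (x m)) with hS₁
  set S₂ : (ℕ → Plane) → ℝ≥0∞ := fun y => expNeg (∑' m, w c₂ (y m)) with hS₂
  have hm₁ : Measurable S₁ := by
    refine Measurable.tsum fun n => Measurable.mul ?_ (measurable_expNeg.comp
      (Measurable.tsum fun m => ?_))
    · exact (measurable_one.indicator hA).comp (measurable_pi_apply n)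
    · split_ifs
      · exact measurable_const
      · exact (hwm c₁).comp (measurable_pi_apply m)
  have hm₂ : Measurable S₂ := measurable_expNeg.comp
    (Measurable.tsum fun m => (hwm c₂).comp (measurable_pi_apply m))
  have hmX : Measurable fun ω n => X n ω := measurable_pi_lambda _ hX.measurable
  have hmY : Measurable fun ω n => Y n ω := measurable_pi_lambda _ hY.measurable
  have hsplit : ∀ ω, ∑' n, A.indicator 1 (X n ω) * interferenceFactor α b c₁ c₂ σ X Y r n ω
      = S₁ (fun n => X n ω) * S₂ (fun n => Y n ω) * expNeg (ENNReal.ofReal (b * r ^ α * σ)) := by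
    intro ω
    rw [← ENNReal.tsum_mul_right, ← ENNReal.tsum_mul_right]
    refine tsum_congr fun n => ?_
    rw [interferenceFactor, expNeg_add, expNeg_add, ← mul_assoc, ← mul_assoc]
  have hind := lintegral_mul_eq_lintegral_mul_lintegral_of_indepFun (hm₁.comp hmX) (hm₂.comp hmY)
    (hXY.comp hm₁ hm₂)
  simp only [hsplit]
  rw [lintegral_mul_const' _ _ (expNeg_ne_top _)]
  refine (congrArg (· * _) hind).trans ?_
  have e₁ : ∫⁻ ω, (S₁ ∘ fun ω n => X n ω) ω ∂μ = _ :=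
    hX.lintegral_tsum_indicator_mul_expNeg hd₁ (hwm c₁) (hwt c₁) hA
  have e₂ : ∫⁻ ω, (S₂ ∘ fun ω n => Y n ω) ω ∂μ = _ := hY.lintegral_expNeg_tsum hd₂ (hwm c₂)
  rw [e₁, e₂, hwi c₁ d₁ h₁ hd₁, hwi c₂ d₂ h₂ hd₂, expNeg_ofReal (by positivity), mul_assoc, mul_assoc,
    ← ENNReal.ofReal_mul (Real.exp_pos _).le, ← ENNReal.ofReal_mul (Real.exp_pos _).le,
    ← mul_assoc (Real.exp _), ← Real.exp_add]
  congr 4; ring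

/-- The interference weight of each station when the station `inl n` serves. -/
def interferenceWeight (α b c₁ c₂ : ℝ) (n : ℕ) (z : Station → Plane) : Station → ℝ≥0∞
  | Sum.inl m => if m = n then 0 else
      ENNReal.ofReal (b * ‖z (Sum.inl n)‖ ^ α * c₁) * pathLoss α (z (Sum.inl m))
  | Sum.inr m => ENNReal.ofReal (b * ‖z (Sum.inl n)‖ ^ α * c₂) * pathLoss α (z (Sum.inr m))

lemma measurable_interferenceWeight (α b c₁ c₂ : ℝ) (n : ℕ) (s : Station) :
    Measurable fun z => interferenceWeight α b c₁ c₂ n z s := by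
  rcases s with m | m
  · simp only [interferenceWeight]
    split_ifs <;> fun_prop
  · simp only [interferenceWeight]
    fun_prop

lemma interferenceWeight_ne_top (α b c₁ c₂ : ℝ) (n : ℕ) (z : Station → Plane) (s : Station) :
    interferenceWeight α b c₁ c₂ n z s ≠ ∞ := by
  rcases s with m | m
  · simp only [interferenceWeight]
    split_ifs
    · simp
    · exact ENNReal.mul_ne_top ENNReal.ofReal_ne_top (pathLoss_ne_top _ _)
  · exact ENNReal.mul_ne_top ENNReal.ofReal_ne_top (pathLoss_ne_top _ _)

lemma tsum_station (f : Station → ℝ≥0∞) :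
    ∑' s, f s = ∑' m, f (Sum.inl m) + ∑' m, f (Sum.inr m) :=
  Summable.tsum_sum ENNReal.summable ENNReal.summable

/-- The positions and gains for which the signal of the station `inl n` exceeds, after scaling, the
weighted interference and the noise. -/
def servingSet (α b c₁ c₂ σ : ℝ) (n : ℕ) : Set ((Station → Plane) × (Station → ℝ)) :=
  {z | ∑' s, interferenceWeight α b c₁ c₂ n z.1 s * ENNReal.ofReal (z.2 s)
    + ENNReal.ofReal (b * ‖z.1 (Sum.inl n)‖ ^ α * σ) < ENNReal.ofReal (z.2 (Sum.inl n))}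

lemma measurableSet_servingSet (α b c₁ c₂ σ : ℝ) (n : ℕ) :
    MeasurableSet (servingSet α b c₁ c₂ σ n) := by
  refine measurableSet_lt ((Measurable.tsum fun s => ?_).add (by fun_prop)) (by fun_prop)
  exact ((measurable_interferenceWeight α b c₁ c₂ n s).comp measurable_fst).mul (by fun_prop)

/-- The mean number of stations `inl n` whose scaled signal exceeds the weighted interference. -/
theorem tsum_measure_interference_lt {α b c₁ c₂ σ d₁ d₂ : ℝ} (hα : 2 < α)
    (hb : 0 ≤ b) (h₁ : 0 ≤ c₁) (h₂ : 0 ≤ c₂) (hσ : 0 ≤ σ) (hd₁ : 0 ≤ d₁) (hd₂ : 0 ≤ d₂)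
    {pos : Station → Ω → Plane} {fad : Station → Ω → ℝ}
    (hX : IsPoissonProcess μ (fun n => pos (Sum.inl n)) d₁)
    (hY : IsPoissonProcess μ (fun n => pos (Sum.inr n)) d₂)
    (hXY : IndepFun (fun ω n => pos (Sum.inl n) ω) (fun ω n => pos (Sum.inr n) ω) μ)
    (hfm : ∀ s, Measurable (fad s)) (hfl : ∀ s, μ.map (fad s) = expMeasure 1)
    (hfi : iIndepFun fad μ) (hpf : IndepFun (fun ω s => pos s ω) (fun ω s => fad s ω) μ) :
    ∑' n, μ {ω | (fun s => pos s ω, fun s => fad s ω) ∈ servingSet α b c₁ c₂ σ n}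
      = ENNReal.ofReal d₁ * ∫⁻ x : Plane, ENNReal.ofReal
        (Real.exp (-(Real.pi * ‖x‖ ^ 2 * b ^ (2 / α) *
          ((2 * Real.pi / α) / Real.sin (2 * Real.pi / α)) *
          (d₁ * c₁ ^ (2 / α) + d₂ * c₂ ^ (2 / α)))) * Real.exp (-(b * ‖x‖ ^ α * σ))) := by
  have hpm : ∀ s, Measurable (pos s) := by
    rintro (n | n)
    · exact hX.measurable n
    · exact hY.measurable n
  have hP : Measurable fun ω s => pos s ω := measurable_pi_lambda _ hpm
  have hF : Measurable fun ω s => fad s ω := measurable_pi_lambda _ hfm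
  set X : ℕ → Ω → Plane := fun n => pos (Sum.inl n) with hXdef
  set Y : ℕ → Ω → Plane := fun n => pos (Sum.inr n) with hYdef
  -- Condition on the positions. The serving station has interference weight 0, so the tail formula
  -- for independent exponential gains applies.
  have hprob : ∀ n, μ {ω | (fun s => pos s ω, fun s => fad s ω) ∈ servingSet α b c₁ c₂ σ n}
      = ∫⁻ ω, interferenceFactor α b c₁ c₂ σ X Y ‖X n ω‖ n ω ∂μ := by
    intro n
    have hB := measurableSet_servingSet α b c₁ c₂ σ n
    have h := measure_prodMk_mem_of_indepFun hP hF hpf hB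
    simp only [servingSet, Set.mem_ofPred_eq] at h ⊢
    refine h.trans (lintegral_congr fun ω => ?_)
    refine (measure_tsum_lt_fading hfm hfl hfi
      (interferenceWeight_ne_top α b c₁ c₂ n fun s => pos s ω) (n := Sum.inl n)
      (by simp [interferenceWeight]) _).trans ?_
    rw [tsum_station]
    simp only [interferenceFactor, interferenceWeight, apply_ite logOneAdd, logOneAdd_zero]
    rfl
  simp only [hprob]
  rw [← lintegral_tsum fun n => (measurable_interferenceFactor hX.measurable hY.measurable
    (hX.measurable n).norm n).aemeasurable]
  have hC0 := sinc_two_pi_div_pos hα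
  refine lintegral_tsum_norm (G := interferenceFactor α b c₁ c₂ σ X Y) (Φ := fun r => ENNReal.ofReal
      (Real.exp (-(Real.pi * r ^ 2 * b ^ (2 / α) * ((2 * Real.pi / α) / Real.sin (2 * Real.pi / α)) *
      (d₁ * c₁ ^ (2 / α) + d₂ * c₂ ^ (2 / α)))) * Real.exp (-(b * r ^ α * σ))))
    hX.measurable hX.ae_ne_zero
    (fun r n => measurable_interferenceFactor hX.measurable hY.measurable measurable_const n)
    (fun r s hr hrs n ω => interferenceFactor_anti (by linarith) hb h₁ h₂ hσ X Y hr hrs n ω)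
    ?_ (by fun_prop) (fun r hr A hA => lintegral_tsum_indicator_mul_interferenceFactor hα hb h₁ h₂
      hσ hd₁ hd₂ hX hY hXY hr hA)
  intro r hr s hs hrs
  have hr0 : (0 : ℝ) < r := hr
  have hp : r ^ α ≤ s ^ α := Real.rpow_le_rpow hr0.le hrs (by linarith)
  refine ENNReal.ofReal_le_ofReal ?_
  gcongr

end Coverage

/-! ### Signs of the coefficients `ζ` and `υ` -/

/-- Raising `m` by one multiplies the left side by `m + 1` and the right side by the larger `m + 1 +
s`. With `m = 2 ^ B` and `s = 1 / (N_B - 1)`, this is the inequality `2 ^ B β(2 ^ B, 1 + s) < 1`,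
that is, `ζ > 0`. -/
lemma Gamma_add_one_mul_Gamma_one_add_lt {s : ℝ} (hs : 0 < s) {m : ℕ} (hm : 1 ≤ m) :
    Real.Gamma (m + 1) * Real.Gamma (1 + s) < Real.Gamma (m + (1 + s)) := by
  have h1 : 0 < Real.Gamma (1 + s) := Real.Gamma_pos_of_pos (by linarith)
  induction m, hm using Nat.le_induction with
  | base =>
    rw [Nat.cast_one, add_comm (1 : ℝ) (1 + s), Real.Gamma_add_one (by linarith : (1 + s) ≠ 0),
      Real.Gamma_add_one one_ne_zero, Real.Gamma_one]
    nlinarith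
  | succ m hm ih =>
    have hm0 : (0 : ℝ) < m := by exact_mod_cast hm
    have h2 : 0 < Real.Gamma (m + 1) := Real.Gamma_pos_of_pos (by linarith)
    rw [Nat.cast_succ, Real.Gamma_add_one (by linarith : ((m : ℝ) + 1) ≠ 0),
      show (m : ℝ) + 1 + (1 + s) = (m + (1 + s)) + 1 by ring,
      Real.Gamma_add_one (by linarith : ((m : ℝ) + (1 + s)) ≠ 0)]
    nlinarith [mul_pos h2 h1]

namespace RadioParams

variable {p : RadioParams}

lemma Valid.zeta_pos (hp : p.Valid) : 0 < p.zeta := by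
  have hN : (2 : ℝ) ≤ p.antennas := by exact_mod_cast hp.two_le_antennas
  have hN1 : (0 : ℝ) < (p.antennas : ℝ) - 1 := by linarith
  have he : (p.antennas : ℝ) / ((p.antennas : ℝ) - 1) = 1 + 1 / ((p.antennas : ℝ) - 1) := by
    field_simp
    ring
  have h := Gamma_add_one_mul_Gamma_one_add_lt (s := 1 / ((p.antennas : ℝ) - 1)) (by positivity)
    (Nat.one_le_two_pow : 1 ≤ 2 ^ p.bits)
  push_cast at h
  have h2 : (0 : ℝ) < 2 ^ p.bits := by positivity
  rw [Real.Gamma_add_one h2.ne'] at h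
  have h3 : 0 < Real.Gamma ((2 : ℝ) ^ p.bits + (1 + 1 / ((p.antennas : ℝ) - 1))) :=
    Real.Gamma_pos_of_pos (by positivity)
  rw [zeta, he, ProbabilityTheory.beta, sub_pos, ← mul_div_assoc, ← mul_assoc, div_lt_one h3]
  exact h

lemma Valid.upsilon_pos (_ : p.Valid) : 0 < p.upsilon := Real.rpow_pos_of_pos two_pos _

lemma Valid.upsilon_le_one (hp : p.Valid) : p.upsilon ≤ 1 := by
  have hN : (2 : ℝ) ≤ p.antennas := by exact_mod_cast hp.two_le_antennas
  have hN1 : (0 : ℝ) < (p.antennas : ℝ) - 1 := by linarith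
  refine Real.rpow_le_one_of_one_le_of_nonpos one_le_two ?_
  rw [neg_nonpos]
  positivity

end RadioParams

/-! ### Latency targets as SINR thresholds -/

section Delay

lemma ofReal_lt_shannonRate_iff {κ : ℝ} (hκ : 0 ≤ κ) (γ : ℝ≥0∞) :
    ENNReal.ofReal κ < shannonRate γ ↔ ENNReal.ofReal ((2 : ℝ) ^ κ - 1) < γ := by
  have hlog : 0 < Real.log 2 := Real.log_pos one_lt_two
  have h1 : (1 : ℝ) ≤ 2 ^ κ := Real.one_le_rpow one_le_two hκ
  have h2 : shannonRate γ = logOneAdd γ / ENNReal.ofReal (Real.log 2) := rfl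
  rw [h2, ENNReal.lt_div_iff_mul_lt (Or.inl (by simpa using hlog)) (Or.inl ENNReal.ofReal_ne_top),
    ← ENNReal.ofReal_mul hκ, ← EReal.coe_ennreal_lt_coe_ennreal_iff, logOneAdd_coe,
    ← EReal.exp_lt_exp_iff, ENNReal.exp_log, EReal.coe_ennreal_ofReal,
    max_eq_left (by positivity), EReal.exp_coe, mul_comm, ← Real.rpow_def_of_pos two_pos,
    ENNReal.ofReal_sub _ zero_le_one, ENNReal.ofReal_one]
  refine (ENNReal.sub_lt_iff_lt_left ENNReal.one_ne_top ?_).symm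
  simpa using h1

namespace DelayParams

variable {q : DelayParams}

lemma Valid.kappa_pos (hq : q.Valid) (i : Tier) : 0 < q.kappa i := by
  have h1 := hq.users_nonneg i
  have h2 := hq.reqRate_nonneg
  have h3 := hq.len_pos
  have h4 := sub_pos.2 (hq.extra_lt_target i)
  unfold kappa
  positivity

/-- No case split on `R` is needed. If the rate does not exceed the traffic, truncated subtraction
gives the denominator 0, and since `len > 0` the latency is infinite. -/
lemma Valid.latency_lt_iff (hq : q.Valid) (i : Tier) (R : ℝ≥0∞) :
    q.latency i R < ENNReal.ofReal (q.target i) ↔ ENNReal.ofReal (q.kappa i) < R := by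
  have h1 := hq.users_nonneg i
  have h2 := hq.reqRate_nonneg
  have h3 := hq.len_pos
  have h4 := sub_pos.2 (hq.extra_lt_target i)
  have h5 : 0 ≤ q.extra i := by
    cases i
    · exact le_rfl
    · exact hq.back_nonneg
    · exact hq.front_nonneg
  rw [latency, ← lt_tsub_iff_right, ← ENNReal.ofReal_sub _ h5,
    ENNReal.div_lt_iff (Or.inr (by simpa using h3)) (Or.inr ENNReal.ofReal_ne_top), mul_comm,
    ← ENNReal.div_lt_iff (Or.inl (by simpa using h4)) (Or.inl ENNReal.ofReal_ne_top),
    ← ENNReal.ofReal_div_of_pos h4, lt_tsub_iff_right, ← ENNReal.ofReal_add (by positivity)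
    (by positivity), kappa, add_comm]

end DelayParams

end Delay

/-! ### SINR events and uniqueness of the qualifying station -/

section Events

/-- The transmit power of a station. -/
def RadioParams.stationPow (p : RadioParams) : Station → ℝ
  | Sum.inl _ => p.powF
  | Sum.inr _ => p.powR

variable {Ω : Type*} {p : RadioParams} {net : Network Ω}

lemma RadioParams.Valid.stationPow_pos (hp : p.Valid) (s : Station) : 0 < p.stationPow s := by
  rcases s with n | n
  · exact hp.powF_pos
  · exact hp.powR_pos

lemma Network.rx_eq (hp : p.Valid) (ω : Ω) (s : Station) :
    net.rx p ω s = ENNReal.ofReal (p.stationPow s) * pathLoss p.α (net.position s ω) *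
      ENNReal.ofReal (net.fading s ω) := by
  have h : p.pow (net.tier ω s) = p.stationPow s := by
    rcases s with n | n
    · by_cases hc : net.hasContent n ω <;>
        simp [Network.tier, hc, RadioParams.pow, RadioParams.stationPow]
    · rfl
  have h0 := (hp.stationPow_pos s).le
  rw [Network.rx, h, pathLoss, ← ENNReal.ofReal_mul h0, ← ENNReal.ofReal_mul (by positivity)]
  congr 1; ring

/-- The origin is excluded because `‖0‖ ^ (-α)` is 0 by convention, which would make the signal
vanish there. -/
lemma ofReal_lt_signal_div_iff {α η t : ℝ} (hη : 0 < η) (ht : 0 < t) {x : Plane} (hx : x ≠ 0)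
    (h I : ℝ≥0∞) :
    ENNReal.ofReal η < ENNReal.ofReal t * pathLoss α x * h / I ↔
      ENNReal.ofReal (η / t * ‖x‖ ^ α) * I < h := by
  have hr : 0 < ‖x‖ ^ α := Real.rpow_pos_of_pos (norm_pos_iff.2 hx) α
  have hk : 0 < t * ‖x‖ ^ (-α) := mul_pos ht (Real.rpow_pos_of_pos (norm_pos_iff.2 hx) _)
  have he : ENNReal.ofReal η = ENNReal.ofReal (t * ‖x‖ ^ (-α)) *
      ENNReal.ofReal (η / t * ‖x‖ ^ α) := by
    rw [← ENNReal.ofReal_mul hk.le, Real.rpow_neg (norm_nonneg x)]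
    congr 1
    field_simp
  rw [ENNReal.lt_div_iff_mul_lt (Or.inr ENNReal.ofReal_ne_top) (Or.inr (by simpa using hη)),
    pathLoss, ← ENNReal.ofReal_mul ht.le, he, mul_assoc]
  exact ENNReal.mul_lt_mul_iff_right (by simpa using hk) ENNReal.ofReal_ne_top

lemma Network.lt_sinr_inl_iff (hp : p.Valid) {η : ℝ} (hη : 0 < η) {ω : Ω} {n : ℕ}
    (hx : net.position (Sum.inl n) ω ≠ 0) :
    ENNReal.ofReal η < net.sinr p ω (Sum.inl n) ↔
      (fun s => net.position s ω, fun s => net.fading s ω) ∈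
        servingSet p.α (η / p.powF) p.powF p.powR p.noise n := by
  have hF := hp.powF_pos
  have hr : 0 ≤ η / p.powF * ‖net.position (Sum.inl n) ω‖ ^ p.α := by positivity
  rw [Network.sinr, Network.rx_eq hp ω (Sum.inl n)]
  refine (ofReal_lt_signal_div_iff hη hF hx _ _).trans ?_
  simp only [servingSet, Set.mem_ofPred_eq]
  rw [tsum_station, mul_add, mul_add, ← ENNReal.tsum_mul_left, ← ENNReal.tsum_mul_left,
    ← ENNReal.ofReal_mul hr]
  simp only [Network.rx_eq hp, RadioParams.stationPow, interferenceWeight, mul_ite, ite_mul, mul_zero,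
    zero_mul, ENNReal.ofReal_mul hr]
  simp only [mul_assoc]

/-- Swapping the two kinds of station puts the RRHs in the serving role `inl`. The coefficient `ζ`
is absorbed into the serving power and `υ` into the power of the interfering RRHs. -/
lemma Network.lt_sinr_inr_iff (hp : p.Valid) {η : ℝ} (hη : 0 < η) {ω : Ω} {n : ℕ}
    (hx : net.position (Sum.inr n) ω ≠ 0) :
    ENNReal.ofReal η < net.sinr p ω (Sum.inr n) ↔
      (fun s : Station => net.position s.swap ω, fun s : Station => net.fading s.swap ω) ∈
        servingSet p.α (η / (p.zeta * p.powR)) (p.upsilon * p.powR) p.powF p.noise n := by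
  have hR := hp.powR_pos
  have hζ := hp.zeta_pos
  have hυ := hp.upsilon_pos
  have hr : 0 ≤ η / (p.zeta * p.powR) * ‖net.position (Sum.inr n) ω‖ ^ p.α := by positivity
  rw [Network.sinr, Network.rx_eq hp ω (Sum.inr n), RadioParams.stationPow, ← mul_assoc, ← mul_assoc,
    ← ENNReal.ofReal_mul hζ.le]
  refine (ofReal_lt_signal_div_iff hη (mul_pos hζ hR) hx _ _).trans ?_
  simp only [servingSet, Set.mem_ofPred_eq]
  rw [tsum_station, add_comm (∑' m, net.rx p ω (Sum.inl m)), mul_add, mul_add,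
    ← ENNReal.tsum_mul_left, ← ENNReal.tsum_mul_left, ← ENNReal.tsum_mul_left]
  simp only [Network.rx_eq hp, RadioParams.stationPow, interferenceWeight, mul_ite, ite_mul, mul_zero,
    zero_mul, ENNReal.ofReal_mul hr, ENNReal.ofReal_mul hυ.le, Sum.swap_inl, Sum.swap_inr]
  simp only [mul_assoc]

/-- The interference at `s` contains the signal of `t`. If `s` is an F-AP, that signal has
coefficient 1 and the threshold exceeds 1. If `s` is an RRH, the coefficient is 1 or `υ`, and `ζ ≤ ζ
/ υ < η` because `υ ≤ 1`, so the threshold times the coefficient is at least `ζ` in either case. -/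
lemma Network.rx_lt_rx_of_lt_sinr (hp : p.Valid) {η : Tier → ℝ} (hη : p.LargeThresholds η) {ω : Ω}
    {s t : Station} (hst : s ≠ t) (h : ENNReal.ofReal (η (net.tier ω s)) < net.sinr p ω s) :
    net.rx p ω t < net.rx p ω s := by
  have hζ := hp.zeta_pos
  have hυ := hp.upsilon_pos
  have hquot : p.zeta ≤ p.zeta / p.upsilon := by
    rw [le_div_iff₀ hυ]
    exact mul_le_of_le_one_right hζ.le hp.upsilon_le_one
  rcases s with n | n
  · have hη1 : 1 < η (net.tier ω (Sum.inl n)) := by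
      by_cases hc : net.hasContent n ω <;> simp [Network.tier, hc, hη.1, hη.2.1]
    have hη1' : (1 : ℝ≥0∞) ≤ ENNReal.ofReal (η (net.tier ω (Sum.inl n))) := by
      simpa using hη1.le
    rw [Network.sinr, ENNReal.lt_div_iff_mul_lt (Or.inr ENNReal.ofReal_ne_top)
      (Or.inr (by simpa using one_pos.trans hη1))] at h
    refine lt_of_le_of_lt ?_ h
    refine le_trans ?_ (le_mul_of_one_le_left' hη1')
    rcases t with m | m
    · have hmn : m ≠ n := fun e => hst (by rw [e])
      refine le_add_right (le_add_right ?_)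
      refine le_trans ?_ (ENNReal.le_tsum m)
      rw [if_neg hmn]
    · exact le_add_right (le_add_left (ENNReal.le_tsum m))
  · have hηR : p.zeta / p.upsilon < η .rrh := hη.2.2
    have hη0 : 0 < η .rrh := hζ.trans_le hquot |>.trans hηR
    change ENNReal.ofReal (η .rrh) < _ at h
    rw [Network.sinr, ENNReal.lt_div_iff_mul_lt (Or.inr ENNReal.ofReal_ne_top)
      (Or.inr (by simpa using hη0))] at h
    have hζ' : ENNReal.ofReal p.zeta ≠ 0 := by simpa using hζ
    refine (ENNReal.mul_lt_mul_iff_right hζ' ENNReal.ofReal_ne_top).1 (lt_of_le_of_lt ?_ h)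
    rcases t with m | m
    · refine mul_le_mul' (ENNReal.ofReal_le_ofReal (hquot.trans hηR.le)) ?_
      exact le_add_right (le_add_right (ENNReal.le_tsum m))
    · have hmn : m ≠ n := fun e => hst (by rw [e])
      calc ENNReal.ofReal p.zeta * net.rx p ω (Sum.inr m)
          ≤ ENNReal.ofReal (η .rrh * p.upsilon) * net.rx p ω (Sum.inr m) := by
            gcongr
            exact ((div_lt_iff₀ hυ).1 hηR).le
        _ = ENNReal.ofReal (η .rrh) * (ENNReal.ofReal p.upsilon * net.rx p ω (Sum.inr m)) := by
            rw [ENNReal.ofReal_mul hη0.le, mul_assoc]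
        _ ≤ _ := by
            refine mul_le_mul_right (le_add_right (le_add_left (mul_le_mul_right ?_ _))) _
            refine le_trans ?_ (ENNReal.le_tsum m)
            rw [if_neg hmn]

/-- At most one station exceeds the threshold of its tier when the thresholds are large. -/
lemma Network.eq_of_lt_sinr (hp : p.Valid) {η : Tier → ℝ} (hη : p.LargeThresholds η) {ω : Ω}
    {s t : Station} (hs : ENNReal.ofReal (η (net.tier ω s)) < net.sinr p ω s)
    (ht : ENNReal.ofReal (η (net.tier ω t)) < net.sinr p ω t) : s = t := by
  by_contra hst
  exact lt_asymm (Network.rx_lt_rx_of_lt_sinr hp hη hst hs)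
    (Network.rx_lt_rx_of_lt_sinr hp hη (Ne.symm hst) ht)

end Events

/-! ### The success probability -/

section Success

variable {Ω : Type*} [MeasurableSpace Ω] {μ : Measure Ω} {p : RadioParams} {net : Network Ω}

lemma IsFogNetwork.measurable_position (hnet : IsFogNetwork μ p net) (s : Station) :
    Measurable (net.position s) := by
  rcases s with n | n
  · exact hnet.fap_poisson.measurable n
  · exact hnet.rrh_poisson.measurable n

lemma RadioParams.Valid.dens_nonneg (hp : p.Valid) (i : Tier) : 0 ≤ p.dens i := by
  have h1 := hp.densF_pos
  have h2 := hp.densR_pos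
  have h3 := hp.pHit_nonneg
  have h4 := sub_nonneg.2 hp.pHit_le_one
  cases i <;> simp only [RadioParams.dens] <;> positivity

lemma mul_integral_eq_toReal {d : ℝ} (hd : 0 ≤ d) {f : Plane → ℝ} (hf : ∀ x, 0 ≤ f x)
    (hfm : Measurable f) :
    d * ∫ x, f x = (ENNReal.ofReal d * ∫⁻ x, ENNReal.ofReal (f x)).toReal := by
  rw [integral_eq_lintegral_of_nonneg_ae (.of_forall hf) hfm.aestronglyMeasurable,
    ENNReal.toReal_mul, ENNReal.toReal_ofReal hd]

/-- The mean number of F-APs, of either tier, at which the SINR exceeds `η`. -/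
def fapMean (p : RadioParams) (η : ℝ) : ℝ≥0∞ :=
  ENNReal.ofReal p.densF * ∫⁻ x : Plane, ENNReal.ofReal
    (Real.exp (-(Real.pi * ‖x‖ ^ 2 * (η / p.powF) ^ (2 / p.α) * p.cAlpha *
      (p.densF * p.powF ^ (2 / p.α) + p.densR * p.powR ^ (2 / p.α)))) *
    Real.exp (-(η / p.powF * ‖x‖ ^ p.α * p.noise)))

/-- The mean number of RRHs at which the SINR exceeds `η`. -/
def rrhMean (p : RadioParams) (η : ℝ) : ℝ≥0∞ :=
  ENNReal.ofReal p.densR * ∫⁻ x : Plane, ENNReal.ofReal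
    (Real.exp (-(Real.pi * ‖x‖ ^ 2 * (η / (p.zeta * p.powR)) ^ (2 / p.α) * p.cAlpha *
      (p.densR * (p.upsilon * p.powR) ^ (2 / p.α) + p.densF * p.powF ^ (2 / p.α)))) *
    Real.exp (-(η / (p.zeta * p.powR) * ‖x‖ ^ p.α * p.noise)))

/-- The two F-AP tiers share one power and their densities add up to `densF`, so in the exponent
they merge into a single interfering tier. -/
lemma RadioParams.Valid.fapTerm_withContent (hp : p.Valid) (η : ℝ) :
    p.fapTerm .withContent η = (ENNReal.ofReal p.pHit * fapMean p η).toReal := by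
  rw [RadioParams.fapTerm, mul_integral_eq_toReal (hp.dens_nonneg _) (fun x => by positivity)
    (by fun_prop), fapMean, ← mul_assoc, ← ENNReal.ofReal_mul hp.pHit_nonneg]
  simp only [RadioParams.dens, RadioParams.pow]
  congr 2
  refine lintegral_congr fun x => ?_
  congr 3
  · ring
  · ring

lemma RadioParams.Valid.fapTerm_withoutContent (hp : p.Valid) (η : ℝ) :
    p.fapTerm .withoutContent η = (ENNReal.ofReal (1 - p.pHit) * fapMean p η).toReal := by
  rw [RadioParams.fapTerm, mul_integral_eq_toReal (hp.dens_nonneg _) (fun x => by positivity)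
    (by fun_prop), fapMean, ← mul_assoc, ← ENNReal.ofReal_mul (sub_nonneg.2 hp.pHit_le_one)]
  simp only [RadioParams.dens, RadioParams.pow]
  congr 2
  refine lintegral_congr fun x => ?_
  congr 3
  · ring
  · ring

lemma RadioParams.Valid.rrhTerm_eq (hp : p.Valid) (η : ℝ) :
    p.rrhTerm η = (rrhMean p η).toReal := by
  rw [RadioParams.rrhTerm, mul_integral_eq_toReal (hp.dens_nonneg _) (fun x => by positivity)
    (by fun_prop), rrhMean]
  simp only [RadioParams.dens, RadioParams.pow]
  congr 2
  refine lintegral_congr fun x => ?_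
  congr 3
  · ring
  · ring

variable [IsProbabilityMeasure μ]

lemma IsFogNetwork.sinr_inl_ae_eq (hp : p.Valid) (hnet : IsFogNetwork μ p net) {η : ℝ}
    (hη : 0 < η) (n : ℕ) :
    {ω | ENNReal.ofReal η < net.sinr p ω (Sum.inl n)} =ᵐ[μ]
      {ω | (fun s => net.position s ω, fun s => net.fading s ω) ∈
        servingSet p.α (η / p.powF) p.powF p.powR p.noise n} := by
  filter_upwards [hnet.fap_poisson.ae_ne_zero n] with ω hω
  exact propext (Network.lt_sinr_inl_iff hp hη hω)

lemma IsFogNetwork.sinr_inr_ae_eq (hp : p.Valid) (hnet : IsFogNetwork μ p net) {η : ℝ}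
    (hη : 0 < η) (n : ℕ) :
    {ω | ENNReal.ofReal η < net.sinr p ω (Sum.inr n)} =ᵐ[μ]
      {ω | (fun s : Station => net.position s.swap ω, fun s : Station => net.fading s.swap ω) ∈
        servingSet p.α (η / (p.zeta * p.powR)) (p.upsilon * p.powR) p.powF p.noise n} := by
  filter_upwards [hnet.rrh_poisson.ae_ne_zero n] with ω hω
  exact propext (Network.lt_sinr_inr_iff hp hη hω)

lemma IsFogNetwork.tsum_measure_inl (hp : p.Valid) (hnet : IsFogNetwork μ p net) {η : ℝ}
    (hη : 0 < η) :
    ∑' n, μ {ω | ENNReal.ofReal η < net.sinr p ω (Sum.inl n)} = fapMean p η := by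
  have h := tsum_measure_interference_lt (μ := μ) (b := η / p.powF) hp.two_lt_α
    (div_pos hη hp.powF_pos).le hp.powF_pos.le hp.powR_pos.le hp.noise_nonneg hp.densF_pos.le
    hp.densR_pos.le hnet.fap_poisson hnet.rrh_poisson hnet.indep_positions hnet.fading_measurable
    hnet.fading_law hnet.fading_indep hnet.indep_fading
  exact (tsum_congr fun n => measure_congr (hnet.sinr_inl_ae_eq hp hη n)).trans h

lemma IsFogNetwork.tsum_measure_inr (hp : p.Valid) (hnet : IsFogNetwork μ p net) {η : ℝ}
    (hη : 0 < η) :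
    ∑' n, μ {ω | ENNReal.ofReal η < net.sinr p ω (Sum.inr n)} = rrhMean p η := by
  have hR := mul_pos hp.zeta_pos hp.powR_pos
  have hswap : Measurable fun (z : Station → Plane) (s : Station) => z s.swap := by fun_prop
  have hswap' : Measurable fun (z : Station → ℝ) (s : Station) => z s.swap := by fun_prop
  have h := tsum_measure_interference_lt (μ := μ) (b := η / (p.zeta * p.powR))
    (pos := fun s => net.position s.swap) (fad := fun s => net.fading s.swap) hp.two_lt_α
    (div_pos hη hR).le (mul_pos hp.upsilon_pos hp.powR_pos).le hp.powF_pos.le hp.noise_nonneg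
    hp.densR_pos.le hp.densF_pos.le hnet.rrh_poisson hnet.fap_poisson hnet.indep_positions.symm
    (fun s => hnet.fading_measurable _) (fun s => hnet.fading_law _)
    (hnet.fading_indep.precomp Sum.swap_leftInverse.injective)
    (hnet.indep_fading.comp hswap hswap')
  exact (tsum_congr fun n => measure_congr (hnet.sinr_inr_ae_eq hp hη n)).trans h

lemma IsFogNetwork.nullMeasurableSet_sinr_inl (hp : p.Valid) (hnet : IsFogNetwork μ p net) {η : ℝ}
    (hη : 0 < η) (n : ℕ) :
    NullMeasurableSet {ω | ENNReal.ofReal η < net.sinr p ω (Sum.inl n)} μ := by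
  have hP : Measurable fun ω s => net.position s ω :=
    measurable_pi_lambda _ hnet.measurable_position
  have hF : Measurable fun ω s => net.fading s ω := measurable_pi_lambda _ hnet.fading_measurable
  exact ((measurableSet_servingSet _ _ _ _ _ n).preimage (hP.prodMk hF)).nullMeasurableSet.congr
    (hnet.sinr_inl_ae_eq hp hη n).symm

lemma IsFogNetwork.nullMeasurableSet_sinr_inr (hp : p.Valid) (hnet : IsFogNetwork μ p net) {η : ℝ}
    (hη : 0 < η) (n : ℕ) :
    NullMeasurableSet {ω | ENNReal.ofReal η < net.sinr p ω (Sum.inr n)} μ := by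
  have hP : Measurable fun ω (s : Station) => net.position s.swap ω :=
    measurable_pi_lambda _ fun s => hnet.measurable_position _
  have hF : Measurable fun ω (s : Station) => net.fading s.swap ω :=
    measurable_pi_lambda _ fun s => hnet.fading_measurable _
  exact ((measurableSet_servingSet _ _ _ _ _ n).preimage (hP.prodMk hF)).nullMeasurableSet.congr
    (hnet.sinr_inr_ae_eq hp hη n).symm

/-- Up to a null set, the SINR event depends on positions and gains alone, hence is independent of
the content indicators. -/
lemma IsFogNetwork.measure_content_inter (hp : p.Valid) (hnet : IsFogNetwork μ p net) {η : ℝ}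
    (hη : 0 < η) (n : ℕ) (c : Bool) :
    μ ({ω | net.hasContent n ω = c} ∩ {ω | ENNReal.ofReal η < net.sinr p ω (Sum.inl n)})
      = ENNReal.ofReal (if c then p.pHit else 1 - p.pHit) *
        μ {ω | ENNReal.ofReal η < net.sinr p ω (Sum.inl n)} := by
  have hS := measurableSet_servingSet p.α (η / p.powF) p.powF p.powR p.noise n
  have hT : MeasurableSet {f : ℕ → Bool | f n = c} :=
    measurableSet_eq_fun (measurable_pi_apply n) measurable_const
  have hind := hnet.indep_content.measure_inter_preimage_eq_mul _ _ hS hT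
  have hlaw : μ {ω | net.hasContent n ω = c} = ENNReal.ofReal (if c then p.pHit else 1 - p.pHit) := by
    have hm : MeasurableSet {ω | net.hasContent n ω = true} :=
      hnet.content_measurable n (measurableSet_singleton true)
    cases c with
    | true => simpa using hnet.content_law n
    | false =>
      have he : {ω | net.hasContent n ω = false} = {ω | net.hasContent n ω = true}ᶜ := by
        ext ω; simp
      rw [he, prob_compl_eq_one_sub hm, hnet.content_law, ← ENNReal.ofReal_one,
        ← ENNReal.ofReal_sub _ hp.pHit_nonneg]
      simp
  have hae := hnet.sinr_inl_ae_eq hp hη n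
  rw [measure_congr ((ae_eq_refl _).inter hae), measure_congr hae, ← hlaw, Set.inter_comm, mul_comm]
  exact hind

/-- The probability that some station exceeds the threshold of its tier. -/
theorem IsFogNetwork.measure_exists_lt_sinr (hp : p.Valid) (hnet : IsFogNetwork μ p net)
    {η : Tier → ℝ} (hη : p.LargeThresholds η) :
    μ {ω | ∃ s, ENNReal.ofReal (η (net.tier ω s)) < net.sinr p ω s}
      = ENNReal.ofReal p.pHit * fapMean p (η .withContent)
        + ENNReal.ofReal (1 - p.pHit) * fapMean p (η .withoutContent) + rrhMean p (η .rrh) := by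
  have hc : 0 < η .withContent := one_pos.trans hη.1
  have hc' : 0 < η .withoutContent := one_pos.trans hη.2.1
  have hR : 0 < η .rrh := (div_pos hp.zeta_pos hp.upsilon_pos).trans hη.2.2
  set E : Station → Set Ω := fun s => {ω | ENNReal.ofReal (η (net.tier ω s)) < net.sinr p ω s}
  have hE : {ω | ∃ s, ENNReal.ofReal (η (net.tier ω s)) < net.sinr p ω s} = ⋃ s, E s := by
    ext ω; simp [E]
  have hdisj : Pairwise (Function.onFun Disjoint E) := fun s t hst =>
    Set.disjoint_left.2 fun ω hs ht => hst (Network.eq_of_lt_sinr hp hη hs ht)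
  -- The threshold of an F-AP depends on its own indicator only, so the marginal law of each
  -- indicator is enough.
  have hinl : ∀ n, E (Sum.inl n) =
      ({ω | net.hasContent n ω = true} ∩
        {ω | ENNReal.ofReal (η .withContent) < net.sinr p ω (Sum.inl n)}) ∪
      ({ω | net.hasContent n ω = false} ∩
        {ω | ENNReal.ofReal (η .withoutContent) < net.sinr p ω (Sum.inl n)}) := by
    intro n
    ext ω
    by_cases h : net.hasContent n ω <;> simp [E, Network.tier, h]
  have hmc : ∀ n (c : Bool), MeasurableSet {ω | net.hasContent n ω = c} := fun n c =>
    hnet.content_measurable n (measurableSet_singleton c)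
  have hm : ∀ s, NullMeasurableSet (E s) μ := by
    rintro (n | n)
    · rw [hinl]
      exact ((hmc n true).nullMeasurableSet.inter (hnet.nullMeasurableSet_sinr_inl hp hc n)).union
        ((hmc n false).nullMeasurableSet.inter (hnet.nullMeasurableSet_sinr_inl hp hc' n))
    · exact hnet.nullMeasurableSet_sinr_inr hp hR n
  have hmeas : ∀ n, μ (E (Sum.inl n)) =
      ENNReal.ofReal p.pHit * μ {ω | ENNReal.ofReal (η .withContent) < net.sinr p ω (Sum.inl n)} +
      ENNReal.ofReal (1 - p.pHit) *
        μ {ω | ENNReal.ofReal (η .withoutContent) < net.sinr p ω (Sum.inl n)} := by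
    intro n
    rw [hinl, measure_union₀ ((hmc n false).nullMeasurableSet.inter
      (hnet.nullMeasurableSet_sinr_inl hp hc' n)), hnet.measure_content_inter hp hc,
      hnet.measure_content_inter hp hc']
    · simp
    · refine Disjoint.aedisjoint (Set.disjoint_left.2 fun ω h1 h2 => ?_)
      have := h1.1.symm.trans h2.1
      simp at this
  rw [hE, measure_iUnion₀ (fun s t hst => (hdisj hst).aedisjoint) hm, tsum_station]
  simp only [hmeas]
  rw [ENNReal.tsum_add, ENNReal.tsum_mul_left, ENNReal.tsum_mul_left,
    hnet.tsum_measure_inl hp hc, hnet.tsum_measure_inl hp hc']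
  congr 1
  exact hnet.tsum_measure_inr hp hR

theorem IsFogNetwork.measureReal_exists_lt_sinr (hp : p.Valid) (hnet : IsFogNetwork μ p net)
    {η : Tier → ℝ} (hη : p.LargeThresholds η) :
    μ.real {ω | ∃ s, ENNReal.ofReal (η (net.tier ω s)) < net.sinr p ω s}
      = p.successFormula η := by
  have h := hnet.measure_exists_lt_sinr hp hη
  -- Finiteness of the three terms needs no estimate: their sum is a probability.
  have hfin := measure_ne_top μ {ω | ∃ s, ENNReal.ofReal (η (net.tier ω s)) < net.sinr p ω s}
  rw [h] at hfin
  obtain ⟨hfin1, hfinR⟩ := ENNReal.add_ne_top.1 hfin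
  obtain ⟨hfinc, hfinc'⟩ := ENNReal.add_ne_top.1 hfin1
  rw [Measure.real, h, ENNReal.toReal_add hfin1 hfinR, ENNReal.toReal_add hfinc hfinc',
    ← hp.fapTerm_withContent, ← hp.fapTerm_withoutContent, ← hp.rrhTerm_eq,
    RadioParams.successFormula, add_comm]

end Success

end FogRAN

end

theorem lemma5 {Ω : Type*} [MeasurableSpace Ω] (μ : MeasureTheory.Measure Ω)
    [MeasureTheory.IsProbabilityMeasure μ]
    (p : FogRAN.RadioParams) (hp : p.Valid)
    (net : FogRAN.Network Ω) (hnet : FogRAN.IsFogNetwork μ p net) :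
    -- the probability that some base station exceeds the SINR threshold of its tier
    (∀ η : FogRAN.Tier → ℝ, p.LargeThresholds η →
      μ.real {ω | ∃ s : FogRAN.Station,
          ENNReal.ofReal (η (net.tier ω s)) < net.sinr p ω s} = p.successFormula η) ∧
    -- the probability that some base station meets the latency target of its tier
    (∀ q : FogRAN.DelayParams, q.Valid →
      -- the service rate is `log₂ (1 + SINR)`
      (p.LargeThresholds (fun i => (2 : ℝ) ^ q.kappa i - 1) →
        μ.real {ω | ∃ s : FogRAN.Station,
            q.latency (net.tier ω s) (FogRAN.shannonRate (net.sinr p ω s))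
              < ENNReal.ofReal (q.target (net.tier ω s))}
          = p.successFormula (fun i => (2 : ℝ) ^ q.kappa i - 1)) ∧
      -- the service rate is identified with the SINR
      (p.LargeThresholds q.kappa →
        μ.real {ω | ∃ s : FogRAN.Station,
            q.latency (net.tier ω s) (net.sinr p ω s)
              < ENNReal.ofReal (q.target (net.tier ω s))}
          = p.successFormula q.kappa)) := by
  -- Both latency events coincide pointwise with the SINR event of part (a), for the thresholds `2 ^
  -- κ - 1` and `κ` respectively.
  refine ⟨fun η hη => hnet.measureReal_exists_lt_sinr hp hη, fun q hq => ⟨fun hη => ?_, fun hη => ?_⟩⟩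
  · simp only [hq.latency_lt_iff, FogRAN.ofReal_lt_shannonRate_iff (hq.kappa_pos _).le]
    exact hnet.measureReal_exists_lt_sinr hp hη
  · simp only [hq.latency_lt_iff]
    exact hnet.measureReal_exists_lt_sinr hp hη
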